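/- **Setting.** A request $r=(a,b;t)$ consists of a start $a$, a destination $b$ (points of a metric space $M$) and a release time $t$; a request sequence $\sigma=(r_1,\dots,r_n)$, $n\ge 1$, has release times $0<t_1<\dots<t_n$. A single server of capacity $c\in\{1,2,\dots\}\cup\{\infty\}$ starts at an origin $O\in M$ at time $0$, moves with speed at most one, collects each request at its start (not before its release time), never carries more than $c$ requests at once, and unloads a request only at its destination (no preemption); it need not return to $O$. As usual, motion is continuous: the server moves in a geodesic metric space $X$ that contains $M$ isometrically ($X=M$ if $M$ is geodesic; every metric space has such an $X$). $\mathrm{Opt}(t)$ denotes the infimum of the completion times of offline solutions (knowing all requests in advance, respecting release times) for the requests released up to time $t$, and $\mathrm{Opt}(\sigma)$ that for all of $\sigma$. For a finite set $R$ of requests and a point $x$, $S(R,x)$ denotes a shortest schedule starting at $x$ and serving $R$, ignoring release times. **The algorithm $\mathrm{Lazy}(\alpha)$, $\alpha\ge 1$.** *Upon receiving a request* at time $t$: if the server can deliver all loaded requests and then reach $O$ by time $\alpha\,\mathrm{Opt}(t)$, it aborts its current command and delivers its loaded requests and returns to $O$ in a shortest way; otherwise it goes on with its current command. *Upon becoming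 (or being) idle* at time $t$, after a request released at that same time has been received: if $t<\alpha\,\mathrm{Opt}(t)$, it waits at its position until time $\alpha\,\mathrm{Opt}(t)$; otherwise, if the set $R_t$ of known unserved requests is non-empty, it follows $S(R_t,p_t)$ from its position $p_t$; otherwise it stays idle. Ties between shortest schedules, and between shortest ways to deliver and return, are broken by a fixed rule: a function of $(R,x)$, respectively of the position and the set of loaded requests. The competitive ratio of $\mathrm{Lazy}(\alpha)$ is $\sup_\sigma \mathrm{Lazy}(\alpha)(\sigma)/\mathrm{Opt}(\sigma)$, where $\mathrm{Lazy}(\alpha)(\sigma)\in[0,\infty]$ is the time at which all requests of $\sigma$ have been served. **Theorem.** Let $\varphi=\frac{1+\sqrt5}{2}$ and let $c\in\{1,2,\dots\}\cup\{\infty\}$. 1. For every metric space $M$, every origin $O\in M$ and every geodesic space $X$ containing $M$ isometrically, tie-breaking rules exist (that is, all the shortest schedules above exist), and for every tie-breaking rule $\mathrm{Lazy}(\varphi)$ has competitive ratio at most $1+\varphi$. The bound is tight: on the real line with origin $0$, $\mathrm{Lazy}(\varphi)$ has competitive ratio exactly $1+\varphi$, for every tie-breaking rule. 2. For every $\alpha\ge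 1$ and every tie-breaking rule, $\mathrm{Lazy}(\alpha)$ has competitive ratio at least $\max\{1+\alpha,\ 2+\frac{2}{3\alpha}\}$ on the real line with origin $0$. -/

import Mathlib

namespace DialARide

universe u

/-- A transportation request `(a, b; t)`: start `a`, destination `b`, release time `t`. -/
@[ext]
structure Request (X : Type u) where
  src : X
  dst : X
  rel : ℝ

/-- The actions of a server: collecting a request and unloading it. -/
inductive Act (X : Type u) where
  | load (r : Request X)
  | unload (r : Request X)

noncomputable instance (X : Type u) : DecidableEq (Request X) := Classical.decEq _

noncomputable instance (X : Type u) : DecidableEq (Act X) := Classical.decEq _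

/-- Where an action has to take place; a request is only unloaded at its destination. -/
def Act.point {X : Type u} : Act X → X
  | .load r => r.src
  | .unload r => r.dst

/-- `Serves c P L l`: a server of capacity `c` which carries the requests `L` can perform the
actions `l` in this order; doing so, it delivers everything in `L`, collects and delivers every
request in `P`, and ends up empty. -/
def Serves {X : Type u} (c : ℕ∞) :
    Finset (Request X) → Finset (Request X) → List (Act X) → Prop
  | P, L, [] => P = ∅ ∧ L = ∅
  | P, L, Act.load r :: l =>
      r ∈ P ∧ (L.card : ℕ∞) + 1 ≤ c ∧ Serves c (P.erase r) (insert r L) l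
  | P, L, Act.unload r :: l => r ∈ L ∧ Serves c P (L.erase r) l

/-- A schedule: the position of the server at each time in `[0, dur]` and the list of the actions
that are performed, with the times at which they are performed. Times are measured from the start
of the schedule. -/
structure Tour (X : Type u) where
  dur : ℝ
  path : ℝ → X
  acts : List (ℝ × Act X)

/-- Stay at `x` for `s` time units. -/
def Tour.stay {X : Type u} (x : X) (s : ℝ) : Tour X where
  dur := s
  path := fun _ => x
  acts := []

/-- `T` can be executed by a server of capacity `c` and speed at most one that starts at `x` with
the requests `L` on board, and it serves exactly the requests in `P` and in `L`. -/
structure Tour.IsFeasible {X : Type u} [MetricSpace X] (c : ℕ∞) (P L : Finset (Request X))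
    (x : X) (T : Tour X) : Prop where
  dur_nonneg : 0 ≤ T.dur
  path_zero : T.path 0 = x
  speed : LipschitzOnWith 1 T.path (Set.Icc 0 T.dur)
  sorted : (T.acts.map Prod.fst).Pairwise (· ≤ ·)
  time_mem : ∀ p ∈ T.acts, p.1 ∈ Set.Icc 0 T.dur
  path_time : ∀ p ∈ T.acts, T.path p.1 = p.2.point
  serves : Serves c P L (T.acts.map Prod.snd)

/-- No request is collected before it is released (for a schedule that starts at time `0`). -/
def Tour.RespectsRelease {X : Type u} (T : Tour X) : Prop :=
  ∀ s r, (s, Act.load r) ∈ T.acts → r.rel ≤ s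

/-- `T` is a shortest schedule that starts at `x` and serves all requests in `R`, ignoring
release times. -/
def Tour.IsShortest {X : Type u} [MetricSpace X] (c : ℕ∞) (R : Finset (Request X)) (x : X)
    (T : Tour X) : Prop :=
  T.IsFeasible c R ∅ x ∧ ∀ T' : Tour X, T'.IsFeasible c R ∅ x → T.dur ≤ T'.dur

/-- `T` is a shortest way to deliver the loaded requests `L`, starting at `x`, and to go to `O`
afterwards. -/
def Tour.IsShortestReturn {X : Type u} [MetricSpace X] (c : ℕ∞) (O x : X)
    (L : Finset (Request X)) (T : Tour X) : Prop :=
  (T.IsFeasible c ∅ L x ∧ T.path T.dur = O) ∧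
    ∀ T' : Tour X, T'.IsFeasible c ∅ L x → T'.path T'.dur = O → T.dur ≤ T'.dur

/-- The offline optimum: the best completion time for the set `R` of requests, of a server that
starts at `O` at time `0`, knows all of `R`, and has to respect the release times. -/
noncomputable def opt {X : Type u} [MetricSpace X] (c : ℕ∞) (O : X) (R : Finset (Request X)) : ℝ :=
  sInf {s | ∃ T : Tour X, T.IsFeasible c R ∅ O ∧ T.RespectsRelease ∧ T.dur = s}

/-- Any two points are joined by a curve whose length is their distance, so that a server of unit
speed can travel from `x` to `y` in time `dist x y`. -/
def IsGeodesic (X : Type u) [MetricSpace X] : Prop :=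
  ∀ x y : X, ∃ γ : ℝ → X, γ 0 = x ∧ γ (dist x y) = y ∧
    ∀ s ∈ Set.Icc 0 (dist x y), ∀ t ∈ Set.Icc 0 (dist x y), dist (γ s) (γ t) = |s - t|

/-- A tie-breaking rule for `Lazy`: a choice of the shortest schedule `S(R, x)` for all `R` and
`x`, and a choice of an optimal execution of the command `deliver_and_return` for every position
`x` and set `L` of loaded requests. -/
structure LazyRule {X : Type u} [MetricSpace X] (c : ℕ∞) (O : X) where
  sched : Finset (Request X) → X → Tour X
  ret : X → Finset (Request X) → Tour X
  sched_shortest : ∀ R x, (sched R x).IsShortest c R x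
  ret_shortest : ∀ x L, (ret x L).IsShortestReturn c O x L

/-- A configuration in the execution of `Lazy`: the requests not yet released (hidden from the
server), the requests released so far, and the current command, which is the schedule `tour`
started at time `start`. The requests in `loaded` are on board at time `start`; those in `waiting`
are the requests among `known` that have not been collected before time `start`. -/
structure Config (X : Type u) where
  future : List (Request X)
  known : Finset (Request X)
  waiting : Finset (Request X)
  loaded : Finset (Request X)
  start : ℝ
  tour : Tour X

namespace Config

variable {X : Type u}

/-- The time at which the current command is completed. -/
noncomputable def finish (C : Config X) : ℝ := C.start + C.tour.dur

/-- The actions of the current command that have been performed by time `t`. -/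
noncomputable def executed (C : Config X) (t : ℝ) : List (Act X) :=
  (C.tour.acts.filter fun p => decide (C.start + p.1 ≤ t)).map Prod.snd

/-- The position of the server at time `t`. -/
noncomputable def posAt (C : Config X) (t : ℝ) : X := C.tour.path (t - C.start)

/-- The known requests that have not been collected by time `t`. -/
noncomputable def waitingAt (C : Config X) (t : ℝ) : Finset (Request X) :=
  C.waiting.filter fun r => Act.load r ∉ C.executed t

/-- The requests on board at time `t`. -/
noncomputable def loadedAt (C : Config X) (t : ℝ) : Finset (Request X) :=
  (C.loaded ∪ C.waiting.filter fun r => Act.load r ∈ C.executed t).filter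
    fun r => Act.unload r ∉ C.executed t

/-- Abort the current command at time `t` and execute the command `T`. -/
noncomputable def execute (C : Config X) (t : ℝ) (T : Tour X) : Config X :=
  { C with
    waiting := C.waitingAt t
    loaded := C.loadedAt t
    start := t
    tour := T }

/-- The server starts at the origin at time `0`, without anything to do. -/
def init (O : X) (σ : List (Request X)) : Config X where
  future := σ
  known := ∅
  waiting := ∅
  loaded := ∅
  start := 0
  tour := Tour.stay O 0

/-- The request `r` becomes known; the current command is not affected. -/
noncomputable def reveal (C : Config X) (r : Request X) (rest : List (Request X)) : Config X :=
  { C with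
    future := rest
    known := insert r C.known
    waiting := insert r C.waiting }

variable [MetricSpace X] {c : ℕ∞} {O : X}

/-- Upon receiving the request `r` (at time `r.rel`): if the loaded requests can be served and the
origin can be reached until time `α * Opt(r.rel)`, then execute `deliver_and_return`; otherwise go
on with the current command. -/
noncomputable def receive (A : LazyRule c O) (α : ℝ) (C : Config X) (r : Request X)
    (rest : List (Request X)) : Config X :=
  let C' := C.reveal r rest
  let T := A.ret (C'.posAt r.rel) (C'.loadedAt r.rel)
  if r.rel + T.dur ≤ α * opt c O C'.known then C'.execute r.rel T else C'

/-- Upon becoming idle, at time `t = C.finish`: if `t < α * Opt(t)`, wait until `α * Opt(t)`;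
otherwise, if there are unserved requests, follow a shortest schedule for them; otherwise remain
idle at the current position until the next request is released, if there is one. -/
noncomputable def becomeIdle (A : LazyRule c O) (α : ℝ) (C : Config X) : Config X :=
  let t := C.finish
  if t < α * opt c O C.known then
    C.execute t (Tour.stay (C.posAt t) (α * opt c O C.known - t))
  else if (C.waitingAt t).Nonempty then
    C.execute t (A.sched (C.waitingAt t) (C.posAt t))
  else
    match C.future with
    | [] => C
    | r :: _ => C.execute t (Tour.stay (C.posAt t) (r.rel - t))

/-- The next event: either a request is released during (or at the end of) the current command, or
the current command is completed. -/
noncomputable def next (A : LazyRule c O) (α : ℝ) (C : Config X) : Config X :=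
  match C.future with
  | [] => C.becomeIdle A α
  | r :: rest => if r.rel ≤ C.finish then C.receive A α r rest else C.becomeIdle A α

end Config

/-- The configuration of `Lazy(α)` on the request sequence `σ` after `m` events. -/
noncomputable def lazyRun {X : Type u} [MetricSpace X] {c : ℕ∞} {O : X} (A : LazyRule c O) (α : ℝ)
    (σ : List (Request X)) (m : ℕ) : Config X :=
  (Config.next A α)^[m] (Config.init O σ)

/-- At time `t`, all requests of `σ` have been released and served by `Lazy(α)`. -/
def LazyDone {X : Type u} [MetricSpace X] {c : ℕ∞} {O : X} (A : LazyRule c O) (α : ℝ)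
    (σ : List (Request X)) (t : ℝ) : Prop :=
  ∃ m, (lazyRun A α σ m).future = [] ∧ (lazyRun A α σ m).start ≤ t ∧
    (lazyRun A α σ m).waitingAt t = ∅ ∧ (lazyRun A α σ m).loadedAt t = ∅

/-- The completion time of `Lazy(α)` on `σ`; it is `∞` if some request is never served. -/
noncomputable def lazyTime {X : Type u} [MetricSpace X] {c : ℕ∞} {O : X} (A : LazyRule c O) (α : ℝ)
    (σ : List (Request X)) : ENNReal :=
  ⨅ (t : ℝ) (_ : LazyDone A α σ t), ENNReal.ofReal t

/-- A (non-empty) request sequence with locations in `M` and release times `0 < t₁ < ⋯ < tₙ`. -/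
structure IsRequestSequence {X : Type u} (M : Set X) (σ : List (Request X)) : Prop where
  ne_nil : σ ≠ []
  rel_pos : ∀ r ∈ σ, 0 < r.rel
  rel_lt : σ.Pairwise fun r r' => r.rel < r'.rel
  src_mem : ∀ r ∈ σ, r.src ∈ M
  dst_mem : ∀ r ∈ σ, r.dst ∈ M

/-- The (strict) competitive ratio of `Lazy(α)` for requests with locations in `M`. -/
noncomputable def lazyRatio {X : Type u} [MetricSpace X] {c : ℕ∞} {O : X} (A : LazyRule c O)
    (α : ℝ) (M : Set X) : ENNReal :=
  ⨆ (σ : List (Request X)) (_ : IsRequestSequence M σ),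
    lazyTime A α σ / ENNReal.ofReal (opt c O σ.toFinset)

end DialARide

open DialARide

/-!
Upper bound: let `α` be at least the golden ratio, that is, `1 + α ≤ α ^ 2`, and call `Q` the
optimum for the requests known at present. The point is that `Lazy(α)` sets out on each schedule
at time `α * Q` exactly, and that the schedule takes at most `Q`. This is clear when the server
starts at `O`. Otherwise it starts at a destination where it arrived by time `(1 + α) * Q'`, on a
schedule begun at time `α * Q'` with the smaller optimum `Q'`, so it is within distance `Q'` of `O`
and the requests to be served were released after time `α * Q'`. As `(1 + α) * Q' ≤ α ^ 2 * Q'` and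
`α * Q' ≤ Q`, it is there in time. If `Q` were at least `2 * α * Q'`, the server could have returned
to `O` by time `α * Q` at the last release; so `Q < 2 * α * Q'`, and this allows the server to catch
up with an optimal offline server.

Lower bounds: a single request at distance one from `O` is reached at time `1 + α` only. For
`2 + 2 / (3 * α)`, two requests lead from `O = 0` to `1` and `-1`, and `Lazy(α)` delivers one of
them first, say `q`. As soon as it has set out, a last request appears on the side of `q`, far out.
With `q` on board the server cannot return to `O` in time, so it continues to the opposite side
before it serves the last request, whereas an offline server delivers `q` last.
-/

namespace DialARide

/-! ### Sequences of actions -/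

section

variable {X : Type*} {c : ℕ∞}

/-- The request that is collected or unloaded by an action. -/
def Act.req : Act X → Request X
  | .load r => r
  | .unload r => r

namespace Serves

variable {P L : Finset (Request X)} {l : List (Act X)}

theorem eq_nil (h : Serves c ∅ (∅ : Finset (Request X)) l) : l = [] := by
  cases l with
  | nil => rfl
  | cons a l => cases a <;> simp [Serves] at h

theorem load_mem_iff (h : Serves c P L l) (r : Request X) : Act.load r ∈ l ↔ r ∈ P := by
  induction l generalizing P L with
  | nil => simp [h.1]
  | cons a l ih => cases a <;> grind [Serves]

theorem unload_mem (h : Serves c P L l) {r : Request X} (hr : r ∈ P ∪ L) :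
    Act.unload r ∈ l := by
  induction l generalizing P L with
  | nil => simp [h.1, h.2] at hr
  | cons a l ih => cases a <;> grind [Serves]

theorem req_mem (h : Serves c P L l) {a : Act X} (ha : a ∈ l) : a.req ∈ P ∪ L := by
  induction l generalizing P L with
  | nil => simp at ha
  | cons b l ih => cases b <;> grind [Serves, Act.req]

theorem length_eq (h : Serves c P L l) (hd : Disjoint P L) : l.length = 2 * P.card + L.card := by
  induction l generalizing P L with
  | nil => simp [h.1, h.2]
  | cons a l ih =>
    simp only [Finset.disjoint_left] at hd ih
    cases a <;> grind [Serves]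

theorem inter (h : Serves c P L l) (R : Finset (Request X)) :
    Serves c (P ∩ R) (L ∩ R) (l.filter fun a => a.req ∈ R) := by
  induction l generalizing P L with
  | nil => simp_all [Serves]
  | cons a l ih =>
    cases a with
    | load r =>
      obtain ⟨hr, hc, h⟩ := h
      by_cases hR : r ∈ R
      · have hcard : (((L ∩ R).card : ℕ) : ℕ∞) + 1 ≤ c :=
          le_trans (by gcongr; exact Finset.inter_subset_left) hc
        have := ih h
        rw [Finset.erase_inter, Finset.insert_inter_of_mem hR] at this
        simpa [Act.req, hR, Serves, hr, hcard] using this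
      · have := ih h
        rw [Finset.erase_inter, Finset.insert_inter_of_notMem hR,
          Finset.erase_eq_of_notMem (by simp [hR])] at this
        simpa [Act.req, hR] using this
    | unload r =>
      obtain ⟨hr, h⟩ := h
      have := ih h
      by_cases hR : r ∈ R
      · simpa [Act.req, hR, Serves, hr, Finset.erase_inter] using this
      · rw [Finset.erase_inter, Finset.erase_eq_of_notMem (by simp [hR])] at this
        simpa [Act.req, hR] using this

theorem of_append {l₁ l₂ : List (Act X)} (hd : Disjoint P L) (h : Serves c P L (l₁ ++ l₂)) :
    Serves c (P.filter fun r => Act.load r ∉ l₁)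
      ((L ∪ P.filter fun r => Act.load r ∈ l₁).filter fun r => Act.unload r ∉ l₁) l₂ := by
  induction l₁ generalizing P L with
  | nil => simpa using h
  | cons a l ih =>
    have hPL := Finset.disjoint_left.1 hd
    cases a with
    | load r =>
      obtain ⟨hr, -, h⟩ := h
      have hd' : Disjoint (P.erase r) (insert r L) :=
        Finset.disjoint_insert_right.2
          ⟨Finset.notMem_erase r P, hd.mono_left (Finset.erase_subset r P)⟩
      convert ih hd' h using 1 <;> grind
    | unload r =>
      obtain ⟨hr, h⟩ := h
      convert ih (hd.mono_right (Finset.erase_subset r L)) h using 1 <;> grind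

theorem exists_eq_append_unload (h : Serves c P L l) (hne : (P ∪ L).Nonempty) :
    ∃ l' q, q ∈ P ∪ L ∧ l = l' ++ [Act.unload q] := by
  suffices ∃ l' q, l = l' ++ [Act.unload q] by
    obtain ⟨l', q, rfl⟩ := this
    exact ⟨l', q, h.req_mem (a := Act.unload q) (by simp), rfl⟩
  induction l generalizing P L with
  | nil => simp [h.1, h.2] at hne
  | cons a l ih =>
    cases a with
    | load r =>
      obtain ⟨l', q, rfl⟩ := ih h.2.2 ⟨r, by simp⟩
      exact ⟨Act.load r :: l', q, rfl⟩
    | unload r =>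
      obtain ⟨-, h⟩ := h
      rcases (P ∪ L.erase r).eq_empty_or_nonempty with he | he
      · obtain ⟨hP, hL⟩ := Finset.union_eq_empty.1 he
        rw [hP, hL] at h
        exact ⟨[], r, by rw [h.eq_nil, List.nil_append]⟩
      · obtain ⟨l', q, rfl⟩ := ih h he
        exact ⟨Act.unload r :: l', q, rfl⟩

theorem exists_eq_load_cons (h : Serves c P ∅ l) (hP : P.Nonempty) :
    ∃ r ∈ P, ∃ l', l = Act.load r :: l' := by
  cases l with
  | nil => exact absurd h.1 hP.ne_empty
  | cons a l => cases a <;> simp_all [Serves]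

theorem eq_of_singleton {r : Request X} (h : Serves c {r} ∅ l) :
    l = [Act.load r, Act.unload r] := by
  obtain ⟨q, hq, l, rfl⟩ := h.exists_eq_load_cons (Finset.singleton_nonempty r)
  obtain rfl := Finset.mem_singleton.1 hq
  obtain ⟨-, -, h⟩ := h
  match l, h with
  | [], h | Act.load _ :: _, h => simp [Serves] at h
  | Act.unload p :: l, h =>
    obtain ⟨hp, h⟩ := h
    obtain rfl : p = q := by simpa using hp
    have hl : l = [] := eq_nil (c := c) (by simpa using h)
    rw [hl]

theorem exists_unload (c : ℕ∞) (L : Finset (Request X)) : ∃ l, Serves c ∅ L l := by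
  induction L using Finset.induction_on with
  | empty => exact ⟨[], rfl, rfl⟩
  | insert r L hr ih =>
    obtain ⟨l, hl⟩ := ih
    exact ⟨Act.unload r :: l, by simp, by rwa [Finset.erase_insert hr]⟩

theorem cons_cons (hc : 1 ≤ c) {r : Request X} (hr : r ∉ P) (h : Serves c P ∅ l) :
    Serves c (insert r P) ∅ (Act.load r :: Act.unload r :: l) := by
  simpa [Serves, hc, Finset.erase_insert hr] using h

theorem exists_serves (hc : 1 ≤ c) (P : Finset (Request X)) : ∃ l, Serves c P ∅ l := by
  induction P using Finset.induction_on with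
  | empty => exact ⟨[], rfl, rfl⟩
  | insert r P hr ih =>
    obtain ⟨l, hl⟩ := ih
    exact ⟨_, hl.cons_cons hc hr⟩

theorem finite_setOf (hd : Disjoint P L) : {l : List (Act X) | Serves c P L l}.Finite := by
  let A : Finset (Act X) := (P ∪ L).image Act.load ∪ (P ∪ L).image Act.unload
  have hA : ∀ l, Serves c P L l → ∀ a ∈ l, a ∈ A := by
    intro l hl a ha
    have := hl.req_mem ha
    cases a <;> simpa [A, Act.req] using this
  refine ((List.finite_length_eq A (2 * P.card + L.card)).image (List.map Subtype.val)).subset ?_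
  intro l hl
  refine ⟨l.attachWith _ (hA l hl), ?_, by simp⟩
  simp [length_eq hl hd]

end Serves

end

/-! ### Itineraries, tours and optima -/

section

variable {X : Type*} {c : ℕ∞}

section

variable [MetricSpace X]

/-- `IsItinerary t x l D z`: a server of unit speed that is at `x` at time `t` can perform the
actions `l` at the prescribed times and be at `z` at time `D`. In contrast to `Tour`, only the
positions at the times of the actions are specified. -/
def IsItinerary : ℝ → X → List (ℝ × Act X) → ℝ → X → Prop
  | t, x, [], D, z => dist x z ≤ D - t
  | t, x, p :: l, D, z => dist x p.2.point ≤ p.1 - t ∧ IsItinerary p.1 p.2.point l D z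

theorem dist_le_sub_of_lipschitzOnWith {f : ℝ → X} {S : Set ℝ}
    (hf : LipschitzOnWith 1 f S) {s t : ℝ} (hs : s ∈ S) (ht : t ∈ S) (hst : s ≤ t) :
    dist (f s) (f t) ≤ t - s := by
  simpa [dist_comm s, Real.dist_eq, abs_of_nonneg (sub_nonneg.2 hst)] using hf.dist_le_mul s hs t ht

theorem lipschitzWith_ite_le {f g : ℝ → X} {a : ℝ} (hf : LipschitzWith 1 f)
    (hg : LipschitzWith 1 g) (h : f a = g a) :
    LipschitzWith 1 fun s => if s ≤ a then f s else g s := by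
  have hgt : ∀ s, a ≤ s → (if s ≤ a then f s else g s) = g s := fun s hs => by
    split_ifs with hsa
    · rw [le_antisymm hsa hs, h]
    · rfl
  refine LipschitzWith.of_dist_le_mul fun s t => ?_
  wlog hst : s ≤ t generalizing s t
  · rw [dist_comm, dist_comm s]
    exact this t s (le_of_not_ge hst)
  rcases le_total t a with hta | hta
  · simpa [hta, hst.trans hta] using hf.dist_le_mul s t
  rcases le_total a s with has | has
  · simpa only [hgt _ hta, hgt _ has] using hg.dist_le_mul s t
  · have hs := dist_le_sub_of_lipschitzOnWith hf.lipschitzOnWith (Set.mem_univ s) trivial has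
    have ht := dist_le_sub_of_lipschitzOnWith hg.lipschitzOnWith (Set.mem_univ a) trivial hta
    rw [hgt t hta, if_pos has, dist_comm s, Real.dist_eq, abs_of_nonneg (sub_nonneg.2 hst),
      NNReal.coe_one, one_mul]
    linarith [dist_triangle (f s) (g a) (g t), h ▸ hs]

variable {t s D D' : ℝ} {x y z w : X} {l l' : List (ℝ × Act X)}

theorem IsGeodesic.exists_lipschitzWith (hX : IsGeodesic X) (h : dist x y ≤ D - t) :
    ∃ f : ℝ → X, f t = x ∧ f D = y ∧ LipschitzWith 1 f := by
  obtain ⟨γ, h0, h1, hγ⟩ := hX x y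
  have hd : (0 : ℝ) ≤ dist x y := dist_nonneg
  refine ⟨fun s => γ (Set.projIcc 0 (dist x y) hd (s - t)), ?_, ?_, ?_⟩
  · simp [h0]
  · simp only [Set.projIcc_of_right_le hd h, h1]
  · have hproj : LipschitzWith (1 * 1) fun s => Set.projIcc 0 (dist x y) hd (s - t) :=
      (LipschitzWith.projIcc hd).comp (LipschitzWith.of_dist_le_mul fun s s' => by simp)
    refine LipschitzWith.of_dist_le_mul fun s s' => ?_
    rw [hγ _ (Subtype.prop _) _ (Subtype.prop _), ← Real.dist_eq, ← Subtype.dist_eq]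
    simpa using hproj.dist_le_mul s s'

namespace IsItinerary

theorem of_le (hl : IsItinerary s y l D z) (h : dist x y ≤ s - t) : IsItinerary t x l D z := by
  cases l with
  | nil =>
    simp only [IsItinerary] at hl ⊢
    linarith [dist_triangle x y z]
  | cons p l => exact ⟨by linarith [dist_triangle x y p.2.point, hl.1], hl.2⟩

theorem extend (hl : IsItinerary t x l D z) (h : dist z w ≤ D' - D) :
    IsItinerary t x l D' w := by
  induction l generalizing t x with
  | nil =>
    simp only [IsItinerary] at hl ⊢
    linarith [dist_triangle x z w]
  | cons p l ih => exact ⟨hl.1, ih hl.2⟩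

theorem sublist (hl : IsItinerary t x l D z) (h : l'.Sublist l) : IsItinerary t x l' D z := by
  induction h generalizing t x with
  | slnil => exact hl
  | cons _ _ ih => exact ih (hl.2.of_le hl.1)
  | cons_cons _ _ ih => exact ⟨hl.1, ih hl.2⟩

theorem dist_le (hl : IsItinerary t x l D z) : dist x z ≤ D - t :=
  hl.sublist (List.nil_sublist l)

theorem dist_le_of_mem (hl : IsItinerary t x l D z) {p : ℝ × Act X} (hp : p ∈ l) :
    dist x p.2.point ≤ p.1 - t ∧ dist p.2.point z ≤ D - p.1 :=
  hl.sublist (List.singleton_sublist.2 hp)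

theorem mem_Icc (hl : IsItinerary t x l D z) {p : ℝ × Act X} (hp : p ∈ l) :
    p.1 ∈ Set.Icc t D := by
  have h := hl.dist_le_of_mem hp
  exact ⟨sub_nonneg.1 (dist_nonneg.trans h.1), sub_nonneg.1 (dist_nonneg.trans h.2)⟩

theorem sorted (hl : IsItinerary t x l D z) : (l.map Prod.fst).Pairwise (· ≤ ·) := by
  induction l generalizing t x with
  | nil => simp
  | cons p l ih =>
    refine List.pairwise_cons.2 ⟨fun s hs => ?_, ih hl.2⟩
    obtain ⟨q, hq, rfl⟩ := List.mem_map.1 hs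
    exact (hl.2.mem_Icc hq).1

theorem shift (hl : IsItinerary t x l D z) (k : ℝ) :
    IsItinerary (t + k) x (l.map fun p => (p.1 + k, p.2)) (D + k) z := by
  induction l generalizing t x with
  | nil => simpa [IsItinerary] using hl
  | cons p l ih => exact ⟨by simpa using hl.1, ih hl.2⟩

theorem of_path {f : ℝ → X} (htD : t ≤ D) (hf : LipschitzOnWith 1 f (Set.Icc t D))
    (hs : (l.map Prod.fst).Pairwise (· ≤ ·)) (hm : ∀ p ∈ l, p.1 ∈ Set.Icc t D)
    (hp : ∀ p ∈ l, f p.1 = p.2.point) : IsItinerary t (f t) l D (f D) := by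
  induction l generalizing t with
  | nil => exact dist_le_sub_of_lipschitzOnWith hf ⟨le_rfl, htD⟩ ⟨htD, le_rfl⟩ htD
  | cons p l ih =>
    have hpm := hm p (by simp)
    rw [List.map_cons, List.pairwise_cons] at hs
    rw [IsItinerary, ← hp p (by simp)]
    refine ⟨dist_le_sub_of_lipschitzOnWith hf ⟨le_rfl, htD⟩ hpm hpm.1,
      ih hpm.2 (hf.mono (Set.Icc_subset_Icc_left hpm.1)) hs.2 (fun q hq => ?_)
        fun q hq => hp q (by simp [hq])⟩
    exact ⟨hs.1 _ (List.mem_map_of_mem hq), (hm q (by simp [hq])).2⟩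

theorem exists_path (hl : IsItinerary t x l D z) (hX : IsGeodesic X) :
    ∃ f : ℝ → X, f t = x ∧ f D = z ∧ LipschitzWith 1 f ∧ ∀ p ∈ l, f p.1 = p.2.point := by
  induction l generalizing t x with
  | nil =>
    obtain ⟨f, ht, hD, hf⟩ := hX.exists_lipschitzWith hl
    exact ⟨f, ht, hD, hf, by simp⟩
  | cons p l ih =>
    obtain ⟨f, hft, hfp, hf⟩ := hX.exists_lipschitzWith hl.1
    obtain ⟨g, hgp, hgD, hg, hgl⟩ := ih hl.2
    have htp : t ≤ p.1 := sub_nonneg.1 (dist_nonneg.trans hl.1)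
    have hpD : p.1 ≤ D := sub_nonneg.1 (dist_nonneg.trans hl.2.dist_le)
    have hpg : ∀ s, p.1 ≤ s → (if s ≤ p.1 then f s else g s) = g s := fun s hs => by
      split_ifs with h
      · rw [le_antisymm h hs, hfp, hgp]
      · rfl
    refine ⟨fun s => if s ≤ p.1 then f s else g s, by simp [htp, hft], (hpg D hpD).trans hgD,
      lipschitzWith_ite_le hf hg (hfp.trans hgp.symm), fun q hq => ?_⟩
    rcases List.mem_cons.1 hq with rfl | hq
    · simp [hfp]
    · exact (hpg _ (hl.2.mem_Icc hq).1).trans (hgl q hq)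

theorem exists_tour {P L : Finset (Request X)} (h : IsItinerary 0 x l D z) (hX : IsGeodesic X)
    (hs : Serves c P L (l.map Prod.snd)) :
    ∃ T : Tour X, T.IsFeasible c P L x ∧ T.dur = D ∧ T.path T.dur = z ∧ T.acts = l := by
  obtain ⟨f, h0, h1, hf, hl⟩ := h.exists_path hX
  refine ⟨⟨D, f, l⟩, ⟨?_, h0, hf.lipschitzOnWith, h.sorted, fun p hp => h.mem_Icc hp, hl, hs⟩,
    rfl, h1, rfl⟩
  simpa using dist_nonneg.trans h.dist_le

end IsItinerary

/-- The length of the route that starts at `x`, performs the actions `l` and ends at `z`. -/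
def routeLength : X → List (Act X) → X → ℝ
  | x, [], z => dist x z
  | x, a :: l, z => dist x a.point + routeLength a.point l z

/-- The position after performing the actions `l` from `x`. -/
def routeEnd : X → List (Act X) → X
  | x, [] => x
  | _, a :: l => routeEnd a.point l

theorem routeLength_routeEnd_le (x : X) (l : List (Act X)) (z : X) :
    routeLength x l (routeEnd x l) ≤ routeLength x l z := by
  induction l generalizing x with
  | nil => simp [routeLength, routeEnd]
  | cons a l ih => simpa [routeLength, routeEnd] using ih a.point

theorem IsItinerary.routeLength_le (h : IsItinerary t x l D z) :
    routeLength x (l.map Prod.snd) z ≤ D - t := by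
  induction l generalizing t x with
  | nil => exact h
  | cons p l ih =>
    simp only [List.map_cons, routeLength]
    linarith [h.1, ih h.2]

theorem exists_isItinerary (t : ℝ) (x : X) (l : List (Act X)) (z : X) :
    ∃ l' : List (ℝ × Act X),
      l'.map Prod.snd = l ∧ IsItinerary t x l' (t + routeLength x l z) z := by
  induction l generalizing t x with
  | nil => exact ⟨[], rfl, by simp [IsItinerary, routeLength]⟩
  | cons a l ih =>
    obtain ⟨l', hl', h⟩ := ih (t + dist x a.point) a.point
    refine ⟨(t + dist x a.point, a) :: l', by simp [hl'], by simp, ?_⟩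
    simpa [routeLength, add_assoc] using h

end

namespace Tour

variable [MetricSpace X] {P L R : Finset (Request X)} {t D : ℝ} {x O z : X}
  {l : List (ℝ × Act X)} {T : Tour X}

theorem isFeasible_stay (x : X) {s : ℝ} (hs : 0 ≤ s) : (stay x s).IsFeasible c ∅ ∅ x where
  dur_nonneg := hs
  path_zero := rfl
  speed := (LipschitzWith.const' x).lipschitzOnWith
  sorted := by simp [stay]
  time_mem := by simp [stay]
  path_time := by simp [stay]
  serves := ⟨rfl, rfl⟩

namespace IsFeasible

theorem isItinerary_from (h : T.IsFeasible c P L x) {s : ℝ} (h0 : 0 ≤ s) (hs : s ≤ T.dur)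
    (hl : l.Sublist T.acts) (hls : ∀ p ∈ l, s ≤ p.1) :
    IsItinerary s (T.path s) l T.dur (T.path T.dur) :=
  .of_path hs (h.speed.mono (Set.Icc_subset_Icc_left h0)) (h.sorted.sublist (hl.map _))
    (fun p hp => ⟨hls p hp, (h.time_mem p (hl.subset hp)).2⟩)
    fun p hp => h.path_time p (hl.subset hp)

theorem isItinerary (h : T.IsFeasible c P L x) :
    IsItinerary 0 x T.acts T.dur (T.path T.dur) := by
  simpa only [h.path_zero] using h.isItinerary_from le_rfl h.dur_nonneg (List.Sublist.refl _)
    fun p hp => (h.time_mem p hp).1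

theorem truncate (h : T.IsFeasible c P L x) {s : ℝ} (h0 : 0 ≤ s) (hs : s ≤ T.dur)
    (hacts : ∀ p ∈ T.acts, p.1 ≤ s) : (⟨s, T.path, T.acts⟩ : Tour X).IsFeasible c P L x :=
  ⟨h0, h.path_zero, h.speed.mono (Set.Icc_subset_Icc_right hs), h.sorted,
    fun p hp => ⟨(h.time_mem p hp).1, hacts p hp⟩, h.path_time, h.serves⟩

theorem serves_filter (h : T.IsFeasible c P ∅ x) (hR : R ⊆ P) :
    Serves c R ∅ ((T.acts.filter fun p => p.2.req ∈ R).map Prod.snd) := by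
  have := h.serves.inter R
  rwa [Finset.inter_eq_right.2 hR, Finset.empty_inter, List.filter_map] at this

theorem exists_load_unload (h : T.IsFeasible c P ∅ x) {r : Request X} (hr : r ∈ P) :
    ∃ s u, (s, Act.load r) ∈ T.acts ∧ (u, Act.unload r) ∈ T.acts ∧
      IsItinerary 0 x [(s, Act.load r), (u, Act.unload r)] T.dur (T.path T.dur) := by
  have hs := (h.serves_filter (R := {r}) (by simpa using hr)).eq_of_singleton
  obtain ⟨⟨s, _⟩, l, hp, rfl, hl⟩ := List.map_eq_cons_iff.1 hs
  obtain ⟨⟨u, _⟩, _, rfl, rfl, hnil⟩ := List.map_eq_cons_iff.1 hl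
  obtain rfl := List.map_eq_nil_iff.1 hnil
  have hsub : [(s, Act.load r), (u, Act.unload r)].Sublist T.acts := hp ▸ List.filter_sublist
  exact ⟨s, u, hsub.subset (by simp), hsub.subset (by simp), h.isItinerary.sublist hsub⟩

theorem exists_acts_eq_append_unload (h : T.IsFeasible c P L x) (hne : (P ∪ L).Nonempty) :
    ∃ l s, ∃ q ∈ P ∪ L, T.acts = l ++ [(s, Act.unload q)] := by
  obtain ⟨l', q, hq, hl⟩ := h.serves.exists_eq_append_unload hne
  obtain ⟨l, _, hacts, rfl, hlast⟩ := List.map_eq_append_iff.1 hl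
  obtain ⟨⟨s, _⟩, _, rfl, rfl, hnil⟩ := List.map_eq_cons_iff.1 hlast
  obtain rfl := List.map_eq_nil_iff.1 hnil
  exact ⟨l, s, q, hq, hacts⟩

end IsFeasible

namespace IsShortest

theorem dur_le (hT : T.IsShortest c R x) (hX : IsGeodesic X) (h : IsItinerary t x l D z)
    (hs : Serves c R ∅ (l.map Prod.snd)) : T.dur ≤ D - t := by
  have h := h.shift (-t)
  rw [add_neg_cancel] at h
  obtain ⟨T', hT', hd, -⟩ :=
    h.exists_tour (c := c) (P := R) (L := ∅) hX (by rw [List.map_map]; exact hs)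
  linarith [hT.2 T' hT']

theorem exists_path_dur_eq_dst (hT : T.IsShortest c R x) (hR : R.Nonempty) :
    ∃ q ∈ R, (T.dur, Act.unload q) ∈ T.acts ∧ T.path T.dur = q.dst := by
  obtain ⟨l, s, q, hq, hl⟩ := hT.1.exists_acts_eq_append_unload (by simpa using hR)
  have hmem : (s, Act.unload q) ∈ T.acts := by simp [hl]
  have hlast : ∀ p ∈ T.acts, p.1 ≤ s := by
    have hsorted := hT.1.sorted
    simp only [hl, List.map_append, List.pairwise_append] at hsorted
    intro p hp
    rcases List.mem_append.1 (hl ▸ hp) with hp | hp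
    · exact hsorted.2.2 _ (List.mem_map_of_mem hp) _ (by simp)
    · rw [List.mem_singleton.1 hp]
  obtain ⟨h0, hs⟩ := hT.1.time_mem _ hmem
  obtain rfl : s = T.dur := le_antisymm hs (hT.2 _ (hT.1.truncate h0 hs hlast))
  exact ⟨q, by simpa using hq, hmem, hT.1.path_time _ hmem⟩

end IsShortest

theorem IsShortestReturn.dur_le (hT : T.IsShortestReturn c O x L) (hX : IsGeodesic X)
    (h : IsItinerary t x l D O) (hs : Serves c ∅ L (l.map Prod.snd)) : T.dur ≤ D - t := by
  have h := h.shift (-t)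
  rw [add_neg_cancel] at h
  obtain ⟨T', hT', hd, hO, -⟩ :=
    h.exists_tour (c := c) (P := ∅) (L := L) hX (by rw [List.map_map]; exact hs)
  linarith [hT.2 T' hT' hO]

theorem exists_isShortest (hX : IsGeodesic X) (hc : 1 ≤ c) (R : Finset (Request X)) (x : X) :
    ∃ T : Tour X, T.IsShortest c R x := by
  obtain ⟨l, hl, hmin⟩ := Set.exists_min_image {l : List (Act X) | Serves c R ∅ l}
    (fun l => routeLength x l (routeEnd x l)) (Serves.finite_setOf (Finset.disjoint_empty_right R))
    (Serves.exists_serves hc R)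
  obtain ⟨l', rfl, h⟩ := exists_isItinerary 0 x l (routeEnd x l)
  obtain ⟨T, hT, hd, -⟩ := h.exists_tour (c := c) (P := R) (L := ∅) hX hl
  refine ⟨T, hT, fun T' hT' => ?_⟩
  linarith [hmin _ hT'.serves, hT'.isItinerary.routeLength_le,
    routeLength_routeEnd_le x (T'.acts.map Prod.snd) (T'.path T'.dur)]

theorem exists_isShortestReturn (hX : IsGeodesic X) (c : ℕ∞) (O x : X) (L : Finset (Request X)) :
    ∃ T : Tour X, T.IsShortestReturn c O x L := by
  obtain ⟨l, hl, hmin⟩ := Set.exists_min_image {l : List (Act X) | Serves c ∅ L l}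
    (fun l => routeLength x l O) (Serves.finite_setOf (Finset.disjoint_empty_left L))
    (Serves.exists_unload c L)
  obtain ⟨l', rfl, h⟩ := exists_isItinerary 0 x l O
  obtain ⟨T, hT, hd, hO, -⟩ := h.exists_tour (c := c) (P := ∅) (L := L) hX hl
  refine ⟨T, ⟨hT, hO⟩, fun T' hT' hO' => ?_⟩
  have hlen := hT'.isItinerary.routeLength_le
  rw [hO'] at hlen
  linarith [hmin _ hT'.serves]

end Tour

section

variable [MetricSpace X] {P R : Finset (Request X)} {O : X} {T : Tour X}

theorem nonempty_lazyRule (hX : IsGeodesic X) (hc : 1 ≤ c) (O : X) :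
    Nonempty (LazyRule c O) := by
  choose S hS using Tour.exists_isShortest hX hc
  choose B hB using Tour.exists_isShortestReturn hX c O
  exact ⟨⟨S, B, hS, hB⟩⟩

theorem opt_le (hT : T.IsFeasible c R ∅ O) (hr : T.RespectsRelease) : opt c O R ≤ T.dur :=
  csInf_le ⟨0, by rintro _ ⟨T, hT, -, rfl⟩; exact hT.dur_nonneg⟩ ⟨T, hT, hr, rfl⟩

theorem opt_le_of_isItinerary (hX : IsGeodesic X) {l : List (ℝ × Act X)} {D : ℝ} {z : X}
    (h : IsItinerary 0 O l D z) (hs : Serves c R ∅ (l.map Prod.snd))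
    (hr : ∀ s r, (s, Act.load r) ∈ l → r.rel ≤ s) : opt c O R ≤ D := by
  obtain ⟨T, hT, rfl, -, rfl⟩ := h.exists_tour (c := c) (P := R) (L := ∅) hX hs
  exact opt_le hT hr

theorem exists_respectsRelease (hX : IsGeodesic X) (hc : 1 ≤ c) (O : X) (R : Finset (Request X)) :
    ∃ T : Tour X, T.IsFeasible c R ∅ O ∧ T.RespectsRelease := by
  obtain ⟨l, hl⟩ := Serves.exists_serves hc R
  obtain ⟨τ, hτ⟩ := (R.finite_toSet.image Request.rel).bddAbove
  obtain ⟨l', rfl, h⟩ := exists_isItinerary (max 0 τ) O l O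
  have h0 : IsItinerary 0 O l' _ O := h.of_le (by simp)
  obtain ⟨T, hT, -, -, rfl⟩ := h0.exists_tour (c := c) (P := R) (L := ∅) hX hl
  refine ⟨T, hT, fun s r hr => ?_⟩
  have hrR : r ∈ R := (hl.load_mem_iff r).1 (List.mem_map_of_mem hr)
  exact (hτ ⟨r, hrR, rfl⟩).trans ((le_max_right _ _).trans (h.mem_Icc hr).1)

theorem le_opt (hX : IsGeodesic X) (hc : 1 ≤ c) {b : ℝ}
    (h : ∀ T : Tour X, T.IsFeasible c R ∅ O → T.RespectsRelease → b ≤ T.dur) :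
    b ≤ opt c O R := by
  obtain ⟨T, hT, hr⟩ := exists_respectsRelease hX hc O R
  refine le_csInf ⟨_, T, hT, hr, rfl⟩ ?_
  rintro _ ⟨T, hT, hr, rfl⟩
  exact h T hT hr

theorem opt_nonneg (c : ℕ∞) (O : X) (R : Finset (Request X)) : 0 ≤ opt c O R :=
  Real.sInf_nonneg (by rintro _ ⟨T, hT, -, rfl⟩; exact hT.dur_nonneg)

theorem opt_mono (hX : IsGeodesic X) (hc : 1 ≤ c) (h : R ⊆ P) : opt c O R ≤ opt c O P :=
  le_opt hX hc fun _ hT hr =>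
    opt_le_of_isItinerary hX (hT.isItinerary.sublist List.filter_sublist) (hT.serves_filter h)
      fun s r hs => hr s r (List.mem_of_mem_filter hs)

theorem rel_le_opt (hX : IsGeodesic X) (hc : 1 ≤ c) {r : Request X} (h : r ∈ R) :
    r.rel ≤ opt c O R := by
  refine le_opt hX hc fun T hT hr => ?_
  obtain ⟨s, u, hs, -⟩ := hT.exists_load_unload h
  exact (hr s r hs).trans (hT.time_mem _ hs).2

theorem dist_dst_le_opt (hX : IsGeodesic X) (hc : 1 ≤ c) {r : Request X} (h : r ∈ R) :
    dist O r.dst ≤ opt c O R := by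
  refine le_opt hX hc fun T hT _ => ?_
  obtain ⟨s, u, -, hu, -⟩ := hT.exists_load_unload h
  have hdist : dist O r.dst ≤ u - 0 := (hT.isItinerary.dist_le_of_mem hu).1
  linarith [(hT.time_mem _ hu).2]

theorem Tour.IsShortest.dur_le_opt (hT : T.IsShortest c R O) (hX : IsGeodesic X) (hc : 1 ≤ c)
    (h : R ⊆ P) : T.dur ≤ opt c O P :=
  le_opt hX hc fun T' hT' _ => by
    simpa using hT.dur_le hX (hT'.isItinerary.sublist List.filter_sublist) (hT'.serves_filter h)

/- An offline solution that finishes before time `2 * τ` visits `q.dst` at some time `u < 2 * τ` and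
collects its first request of `R` at some time `s ≥ τ`, so these two points are within distance
`|u - s| ≤ s`. Hence a server starting at `q.dst` at time `0` can follow it from time `s` on. -/
theorem Tour.IsShortest.dur_le_opt_of_lt {q : Request X} (hT : T.IsShortest c R q.dst)
    (hX : IsGeodesic X) (hc : 1 ≤ c) (h : R ⊆ P) (hR : R.Nonempty) (hq : q ∈ P) {τ : ℝ}
    (hτ : ∀ r ∈ R, τ ≤ r.rel) (hlt : opt c O P < 2 * τ) : T.dur ≤ opt c O P := by
  suffices hmin : min T.dur (2 * τ) ≤ opt c O P from
    (min_le_iff.1 hmin).resolve_right hlt.not_ge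
  refine le_opt hX hc fun T' hT' hr' => min_le_iff.2 (or_iff_not_imp_right.2 fun hdur => ?_)
  obtain ⟨_, u, -, hu, -⟩ := hT'.exists_load_unload hq
  have hserves := hT'.serves_filter h
  have hsub := List.filter_sublist (p := fun p : ℝ × Act X => p.2.req ∈ R) (l := T'.acts)
  obtain ⟨r, hr, _, hmap⟩ := hserves.exists_eq_load_cons hR
  obtain ⟨⟨s, _⟩, l, hl, rfl, -⟩ := List.map_eq_cons_iff.1 hmap
  rw [hl] at hserves hsub
  have hs : (s, Act.load r) ∈ T'.acts := hsub.subset (by simp)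
  have hτs : τ ≤ s := (hτ r hr).trans (hr' s r hs)
  have hdist : dist q.dst r.src ≤ |u - s| := by
    simpa [hT'.path_time _ hu, hT'.path_time _ hs, Act.point, Real.dist_eq] using
      hT'.speed.dist_le_mul u (hT'.time_mem _ hu) s (hT'.time_mem _ hs)
  have hus : |u - s| ≤ s - 0 := by
    obtain ⟨hu0, huD⟩ := hT'.time_mem _ hu
    rw [abs_le]
    constructor <;> simp only at hu0 huD <;> linarith
  simpa using hT.dur_le hX (t := 0) (l := (s, Act.load r) :: l)
    ⟨hdist.trans hus, (hT'.isItinerary.sublist hsub).2⟩ hserves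

end

end

/-! ### Configurations -/

section

variable {X : Type*} {c : ℕ∞}

theorem filter_append_filter_not_of_pairwise {β : Type*} {p : β → Bool} {l : List β}
    (h : l.Pairwise fun a b => p b → p a) : l.filter p ++ l.filter (fun a => !p a) = l := by
  induction l with
  | nil => rfl
  | cons a l ih =>
    obtain ⟨ha, hl⟩ := List.pairwise_cons.1 h
    by_cases hpa : p a
    · simpa [hpa] using ih hl
    · have hnot : ∀ b ∈ l, ¬ p b := fun b hb hpb => hpa (ha b hb hpb)
      have hnil : l.filter p = [] := List.filter_eq_nil_iff.2 hnot
      have hself : l.filter (fun b => !p b) = l := List.filter_eq_self.2 (by simpa using hnot)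
      simp [hpa, hnil, hself]

namespace Config

variable {C : Config X} {t : ℝ} {r : Request X} {rest : List (Request X)}

theorem mem_executed {a : Act X} :
    a ∈ C.executed t ↔ ∃ s, (s, a) ∈ C.tour.acts ∧ C.start + s ≤ t := by
  simp [executed]

theorem posAt_finish (C : Config X) : C.posAt C.finish = C.tour.path C.tour.dur := by
  simp [posAt, finish]

theorem known_execute (C : Config X) (t : ℝ) (T : Tour X) : (C.execute t T).known = C.known := rfl

theorem waiting_execute (C : Config X) (t : ℝ) (T : Tour X) :
    (C.execute t T).waiting = C.waitingAt t := rfl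

theorem executed_stay (C : Config X) (t : ℝ) (x : X) (s u : ℝ) :
    (C.execute t (Tour.stay x s)).executed u = [] := rfl

theorem waitingAt_stay (C : Config X) (t : ℝ) (x : X) (s u : ℝ) :
    (C.execute t (Tour.stay x s)).waitingAt u = C.waitingAt t := by
  rw [waitingAt, executed_stay]
  simp [execute]

theorem finish_stay (C : Config X) (t : ℝ) (x : X) (s : ℝ) :
    (C.execute t (Tour.stay x s)).finish = t + s := rfl

/-- The next event is the release of a request. -/
def ReleaseNext (C : Config X) : Prop :=
  ∃ r ∈ C.future.head?, r.rel ≤ C.finish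

/-- At time `t`, all requests have been released and served. -/
structure IsDoneAt (C : Config X) (t : ℝ) : Prop where
  future_eq : C.future = []
  start_le : C.start ≤ t
  waitingAt_eq : C.waitingAt t = ∅
  loadedAt_eq : C.loadedAt t = ∅

/-- The bookkeeping of the requests is consistent with the request sequence `σ`. -/
structure Tracks (C : Config X) (σ : List (Request X)) : Prop where
  known_union : C.known ∪ C.future.toFinset = σ.toFinset
  pairwise : C.future.Pairwise fun r r' => r.rel < r'.rel
  start_le : ∀ r ∈ C.future, C.start ≤ r.rel
  waiting_subset : C.waiting ⊆ C.known

namespace Tracks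

variable {σ : List (Request X)}

theorem waitingAt_subset (h : C.Tracks σ) (t : ℝ) : C.waitingAt t ⊆ C.known :=
  (Finset.filter_subset _ _).trans h.waiting_subset

theorem reveal (h : C.Tracks σ) (hf : C.future = r :: rest) : (C.reveal r rest).Tracks σ := by
  obtain ⟨hunion, hpair, hstart, hsub⟩ := h
  rw [hf] at hunion hpair hstart
  refine ⟨?_, (List.pairwise_cons.1 hpair).2, fun q hq => hstart q (List.mem_cons_of_mem _ hq),
    Finset.insert_subset_insert _ hsub⟩
  rw [← hunion]
  ext q
  simp [Config.reveal]

theorem execute (h : C.Tracks σ) (ht : ∀ r ∈ C.future, t ≤ r.rel) (T : Tour X) :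
    (C.execute t T).Tracks σ :=
  ⟨h.known_union, h.pairwise, ht, h.waitingAt_subset t⟩

theorem finish_lt (h : C.Tracks σ) (hn : ¬ C.ReleaseNext) : ∀ r ∈ C.future, C.finish < r.rel := by
  have hpair := h.pairwise
  simp only [ReleaseNext, not_exists, not_and, not_le] at hn
  match hF : C.future with
  | [] => simp
  | q :: l =>
    rw [hF] at hpair
    have hq := hn q (by simp [hF])
    exact List.forall_mem_cons.2 ⟨hq, fun r hr => hq.trans ((List.pairwise_cons.1 hpair).1 r hr)⟩

theorem execute_finish (h : C.Tracks σ) (hn : ¬ C.ReleaseNext) (T : Tour X) :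
    (C.execute C.finish T).Tracks σ :=
  h.execute (fun r hr => (h.finish_lt hn r hr).le) T

end Tracks

/-- The server waits at `x`, without any request on board. -/
structure IsIdle (C : Config X) (x : X) : Prop where
  start_le_finish : C.start ≤ C.finish
  loaded_eq : C.loaded = ∅
  acts_eq : C.tour.acts = []
  posAt_eq : ∀ t ∈ Set.Icc C.start C.finish, C.posAt t = x

namespace IsIdle

variable {x : X}

theorem stay (h : C.loadedAt t = ∅) (x : X) {s : ℝ} (hs : 0 ≤ s) :
    (C.execute t (Tour.stay x s)).IsIdle x where
  start_le_finish := le_add_of_nonneg_right hs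
  loaded_eq := h
  acts_eq := rfl
  posAt_eq _ _ := rfl

theorem executed_eq (h : C.IsIdle x) (t : ℝ) : C.executed t = [] := by
  simp [executed, h.acts_eq]

theorem loadedAt_eq (h : C.IsIdle x) (t : ℝ) : C.loadedAt t = ∅ := by
  simp [loadedAt, h.executed_eq, h.loaded_eq]

theorem waitingAt_eq (h : C.IsIdle x) (t : ℝ) : C.waitingAt t = C.waiting := by
  simp [waitingAt, h.executed_eq]

theorem reveal (h : C.IsIdle x) (r : Request X) (rest : List (Request X)) :
    (C.reveal r rest).IsIdle x :=
  ⟨h.start_le_finish, h.loaded_eq, h.acts_eq, h.posAt_eq⟩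

end IsIdle

section Events

variable [MetricSpace X] {O : X} {A : LazyRule c O} {α : ℝ}

theorem next_eq_receive (hf : C.future = r :: rest) (hr : r.rel ≤ C.finish) :
    C.next A α = C.receive A α r rest := by
  simp only [next, hf, if_pos hr]

theorem next_eq_becomeIdle (hn : ¬ C.ReleaseNext) : C.next A α = C.becomeIdle A α := by
  unfold next
  split
  · rfl
  · next r rest hf => rw [if_neg fun hr => hn ⟨r, by simp [hf], hr⟩]

theorem next_eq_wait (hn : ¬ C.ReleaseNext) (hlt : C.finish < α * opt c O C.known) :
    C.next A α = C.execute C.finish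
      (Tour.stay (C.posAt C.finish) (α * opt c O C.known - C.finish)) := by
  simp only [next_eq_becomeIdle hn, becomeIdle, if_pos hlt]

theorem next_eq_sched (hn : ¬ C.ReleaseNext) (hle : α * opt c O C.known ≤ C.finish)
    (hw : (C.waitingAt C.finish).Nonempty) :
    C.next A α =
      C.execute C.finish (A.sched (C.waitingAt C.finish) (C.posAt C.finish)) := by
  simp only [next_eq_becomeIdle hn, becomeIdle, if_neg hle.not_gt, if_pos hw]

theorem next_eq_idle (hn : ¬ C.ReleaseNext) (hle : α * opt c O C.known ≤ C.finish)
    (hw : C.waitingAt C.finish = ∅) (hf : C.future = r :: rest) :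
    C.next A α = C.execute C.finish (Tour.stay (C.posAt C.finish) (r.rel - C.finish)) := by
  simp only [next_eq_becomeIdle hn, becomeIdle, if_neg hle.not_gt, hw, Finset.not_nonempty_empty,
    if_false, hf]

theorem next_eq_self (hle : α * opt c O C.known ≤ C.finish)
    (hw : C.waitingAt C.finish = ∅) (hf : C.future = []) : C.next A α = C := by
  have hn : ¬ C.ReleaseNext := by simp [ReleaseNext, hf]
  simp only [next_eq_becomeIdle hn, becomeIdle, if_neg hle.not_gt, hw, Finset.not_nonempty_empty,
    if_false, hf]

theorem receive_eq_execute (h : r.rel + (A.ret ((C.reveal r rest).posAt r.rel)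
      ((C.reveal r rest).loadedAt r.rel)).dur ≤ α * opt c O (insert r C.known)) :
    C.receive A α r rest = (C.reveal r rest).execute r.rel
      (A.ret ((C.reveal r rest).posAt r.rel) ((C.reveal r rest).loadedAt r.rel)) :=
  if_pos h

theorem receive_eq_reveal (h : α * opt c O (insert r C.known) < r.rel +
      (A.ret ((C.reveal r rest).posAt r.rel) ((C.reveal r rest).loadedAt r.rel)).dur) :
    C.receive A α r rest = C.reveal r rest :=
  if_neg h.not_ge

theorem future_receive : (C.receive A α r rest).future = rest := by
  simp only [receive]
  split_ifs <;> rfl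

theorem Tracks.receive {σ : List (Request X)} (h : C.Tracks σ) (hf : C.future = r :: rest) :
    (C.receive A α r rest).Tracks σ := by
  have hpair := h.pairwise
  rw [hf, List.pairwise_cons] at hpair
  simp only [Config.receive]
  split_ifs
  · exact (h.reveal hf).execute (fun q hq => (hpair.1 q hq).le) _
  · exact h.reveal hf

end Events

variable [MetricSpace X] {O : X} {A : LazyRule c O} {α : ℝ} {P : Finset (Request X)}
  {σ : List (Request X)}

/-- The current command collects exactly the waiting requests in `P`, and delivers them together
with the loaded requests. -/
structure IsServing (c : ℕ∞) (C : Config X) (P : Finset (Request X)) : Prop where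
  feasible : C.tour.IsFeasible c P C.loaded (C.tour.path 0)
  subset : P ⊆ C.waiting
  disjoint : Disjoint P C.loaded

/-- The actions of the current command after time `t` that concern a request which is on board at
time `t`, with the times at which they are performed. -/
noncomputable def deliveries (C : Config X) (t : ℝ) : List (ℝ × Act X) :=
  (C.tour.acts.filter fun p => !decide (C.start + p.1 ≤ t)).filter
    fun p => p.2.req ∈ C.loadedAt t

namespace IsServing

theorem start_le_finish (h : C.IsServing c P) : C.start ≤ C.finish :=
  le_add_of_nonneg_right h.feasible.dur_nonneg

theorem load_mem_executed (h : C.IsServing c P) (hr : Act.load r ∈ C.executed t) : r ∈ P := by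
  obtain ⟨s, hs, -⟩ := mem_executed.1 hr
  exact (h.feasible.serves.load_mem_iff r).1 (List.mem_map_of_mem hs)

theorem loadedAt_eq (h : C.IsServing c P) (t : ℝ) : C.loadedAt t =
    (C.loaded ∪ P.filter fun r => Act.load r ∈ C.executed t).filter
      fun r => Act.unload r ∉ C.executed t := by
  ext r
  have hP := h.load_mem_executed (t := t) (r := r)
  have hsub := @h.subset r
  simp only [loadedAt, Finset.mem_filter, Finset.mem_union]
  tauto

theorem executed_finish (h : C.IsServing c P) :
    C.executed C.finish = C.tour.acts.map Prod.snd := by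
  rw [executed, List.filter_eq_self.2]
  intro p hp
  simpa [finish] using (h.feasible.time_mem p hp).2

theorem waitingAt_finish (h : C.IsServing c P) : C.waitingAt C.finish = C.waiting \ P := by
  ext r
  simp only [waitingAt, h.executed_finish, h.feasible.serves.load_mem_iff, Finset.mem_filter,
    Finset.mem_sdiff]

theorem loadedAt_finish (h : C.IsServing c P) : C.loadedAt C.finish = ∅ := by
  rw [h.loadedAt_eq, h.executed_finish, Finset.filter_eq_empty_iff]
  intro r hr
  have hr' : r ∈ P ∪ C.loaded := by
    simp only [Finset.mem_union, Finset.mem_filter] at hr ⊢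
    tauto
  exact not_not.2 (h.feasible.serves.unload_mem hr')

theorem reveal (h : C.IsServing c P) (r : Request X) (rest : List (Request X)) :
    (C.reveal r rest).IsServing c P :=
  ⟨h.feasible, h.subset.trans (Finset.subset_insert _ _), h.disjoint⟩

theorem serves_deliveries (h : C.IsServing c P) (t : ℝ) :
    Serves c ∅ (C.loadedAt t) ((C.deliveries t).map Prod.snd) := by
  have hsorted : C.tour.acts.Pairwise fun p q =>
      decide (C.start + q.1 ≤ t) → decide (C.start + p.1 ≤ t) := by
    refine (List.pairwise_map.1 h.feasible.sorted).imp fun {p q} hpq hq => ?_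
    simp only [decide_eq_true_eq] at hq ⊢
    linarith
  have hsplit := filter_append_filter_not_of_pairwise hsorted
  have hserves := h.feasible.serves
  rw [← hsplit, List.map_append, ← executed] at hserves
  have hrest := (hserves.of_append h.disjoint).inter (C.loadedAt t)
  have hdisj : Disjoint (P.filter fun r => Act.load r ∉ C.executed t) (C.loadedAt t) := by
    rw [Finset.disjoint_left]
    intro r hr hr'
    rw [h.loadedAt_eq] at hr'
    have hr_loaded : r ∈ P → r ∉ C.loaded := fun hrP => Finset.disjoint_left.1 h.disjoint hrP
    simp only [Finset.mem_filter, Finset.mem_union] at hr hr'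
    tauto
  rw [← h.loadedAt_eq, Finset.inter_self, List.filter_map,
    Finset.disjoint_iff_inter_eq_empty.1 hdisj] at hrest
  exact hrest

theorem ret_dur_le (h : C.IsServing c P) (hX : IsGeodesic X) (A : LazyRule c O)
    (ht : t ∈ Set.Icc C.start C.finish) :
    (A.ret (C.posAt t) (C.loadedAt t)).dur ≤ C.finish - t + dist (C.posAt C.finish) O := by
  have hlate : ∀ p ∈ C.deliveries t, t - C.start ≤ p.1 := fun p hp => by
    simp only [deliveries, List.mem_filter, Bool.not_eq_true', decide_eq_false_iff_not] at hp
    linarith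
  have hreturn := (h.feasible.isItinerary_from (sub_nonneg.2 ht.1) (sub_le_iff_le_add'.2 ht.2)
    (List.filter_sublist.trans List.filter_sublist) hlate).extend (w := O)
    (D' := C.tour.dur + dist (C.tour.path C.tour.dur) O) (by simp)
  have := (A.ret_shortest (C.posAt t) (C.loadedAt t)).dur_le hX hreturn (h.serves_deliveries t)
  rw [posAt_finish, finish]
  linarith

end IsServing

theorem isServing_ret (A : LazyRule c O) (C : Config X) (t : ℝ) (x : X) :
    (C.execute t (A.ret x (C.loadedAt t))).IsServing c ∅ where
  feasible := by
    have := (A.ret_shortest x (C.loadedAt t)).1.1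
    simpa only [execute, this.path_zero] using this
  subset := Finset.empty_subset _
  disjoint := Finset.disjoint_empty_left _

theorem isServing_stay (h : C.loadedAt t = ∅) (x : X) {s : ℝ} (hs : 0 ≤ s) :
    (C.execute t (Tour.stay x s)).IsServing c ∅ where
  feasible := by
    simp only [execute, h]
    exact Tour.isFeasible_stay x hs
  subset := Finset.empty_subset _
  disjoint := Finset.disjoint_empty_left _

theorem isServing_sched (A : LazyRule c O) (h : C.loadedAt t = ∅) (x : X) :
    (C.execute t (A.sched (C.waitingAt t) x)).IsServing c (C.waitingAt t) where
  feasible := by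
    have := (A.sched_shortest (C.waitingAt t) x).1
    simpa only [execute, h, this.path_zero] using this
  subset := Finset.Subset.refl _
  disjoint := by simp [execute, h]

end Config

theorem LazyRule.ret_empty_dur_le [MetricSpace X] (hX : IsGeodesic X) {O : X} (A : LazyRule c O)
    (x : X) : (A.ret x ∅).dur ≤ dist x O := by
  simpa using (A.ret_shortest x ∅).dur_le hX (t := 0) (l := []) (D := dist x O)
    (by simp [IsItinerary]) ⟨rfl, rfl⟩

end

/-! ### The upper bound -/

section

variable {X : Type*} {c : ℕ∞}

theorem one_le_of_goldenRatio_le {α : ℝ} (hα : Real.goldenRatio ≤ α) : 1 ≤ α :=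
  Real.one_lt_goldenRatio.le.trans hα

theorem one_add_le_sq_of_goldenRatio_le {α : ℝ} (hα : Real.goldenRatio ≤ α) : 1 + α ≤ α ^ 2 := by
  nlinarith [Real.goldenRatio_sq, Real.one_lt_goldenRatio]

namespace Config

variable [MetricSpace X] {O : X} {A : LazyRule c O} {α t s Q : ℝ} {C : Config X}
  {P : Finset (Request X)} {σ rest : List (Request X)} {r : Request X}

/-- The current command ends no later than `α * opt`, or at the next release. -/
def InTime (c : ℕ∞) (O : X) (α : ℝ) (C : Config X) : Prop :=
  C.finish ≤ α * opt c O C.known ∨ ∃ r ∈ C.future.head?, C.finish = r.rel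

theorem InTime.finish_le (h : C.InTime c O α) (hn : ¬ C.ReleaseNext) :
    C.finish ≤ α * opt c O C.known :=
  h.resolve_right fun ⟨r, hr, hfin⟩ => hn ⟨r, hr, hfin.ge⟩

theorem InTime.finish_le_insert (hX : IsGeodesic X) (hc : 1 ≤ c) (hα : 1 ≤ α)
    (h : C.InTime c O α) (hf : C.future = r :: rest) :
    C.finish ≤ α * opt c O (insert r C.known) := by
  rcases h with h | ⟨q, hq, h⟩
  · exact h.trans (mul_le_mul_of_nonneg_left (opt_mono hX hc (Finset.subset_insert _ _))
      (zero_le_one.trans hα))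
  · obtain rfl : r = q := by simpa [hf] using hq
    exact h.trans_le ((rel_le_opt hX hc (Finset.mem_insert_self _ _)).trans
      (le_mul_of_one_le_left (opt_nonneg _ _ _) hα))

/-- The current command brings the empty server to the origin. -/
structure IsHome (c : ℕ∞) (O : X) (α : ℝ) (C : Config X) : Prop where
  serving : C.IsServing c ∅
  posAt_eq : C.posAt C.finish = O
  inTime : C.InTime c O α

/-- The server follows a shortest schedule for the requests `P`, started when the optimum was `Q`,
or it waits at the end of such a schedule (and `P` is empty). -/
structure IsAway (c : ℕ∞) (O : X) (α : ℝ) (C : Config X) (P : Finset (Request X)) (Q : ℝ) :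
    Prop where
  serving : C.IsServing c P
  nonneg : 0 ≤ Q
  le_opt : Q ≤ opt c O C.known
  le_start : α * Q ≤ C.start
  dist_le : dist (C.posAt C.finish) O ≤ Q
  exists_dst_eq : ∃ q ∈ C.known, q.dst = C.posAt C.finish
  le_rel : ∀ r ∈ C.waiting \ P, α * Q ≤ r.rel
  opt_lt : (C.waiting \ P).Nonempty → opt c O C.known < 2 * (α * Q)
  phase : C.finish ≤ (1 + α) * Q ∨ C.IsIdle (C.posAt C.finish) ∧ C.InTime c O α

/-- The invariant of the execution of `Lazy(α)`. -/
def LazyInvariant (c : ℕ∞) (O : X) (α : ℝ) (σ : List (Request X)) (C : Config X) : Prop :=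
  C.Tracks σ ∧ (C.IsHome c O α ∨ ∃ P Q, C.IsAway c O α P Q)

section Receive

theorem isHome_ret (h : t + (A.ret (C.posAt t) (C.loadedAt t)).dur ≤ α * opt c O C.known) :
    (C.execute t (A.ret (C.posAt t) (C.loadedAt t))).IsHome c O α where
  serving := isServing_ret A C t _
  posAt_eq := by
    rw [posAt_finish]
    exact (A.ret_shortest _ _).1.2
  inTime := Or.inl h

theorem IsHome.add_ret_dur_le (hX : IsGeodesic X) (A : LazyRule c O) (h : C.IsHome c O α)
    (hr : r.rel ∈ Set.Icc C.start C.finish) :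
    r.rel + (A.ret ((C.reveal r rest).posAt r.rel) ((C.reveal r rest).loadedAt r.rel)).dur ≤
      C.finish := by
  have hret := (h.serving.reveal r rest).ret_dur_le hX A hr
  have hdist : dist ((C.reveal r rest).posAt (C.reveal r rest).finish) O = 0 :=
    dist_eq_zero.2 h.posAt_eq
  have hfin : (C.reveal r rest).finish = C.finish := rfl
  linarith

theorem IsAway.ret_dur_le (hX : IsGeodesic X) (A : LazyRule c O) (h : C.IsAway c O α P Q)
    (hr : r.rel ∈ Set.Icc C.start C.finish) :
    (A.ret ((C.reveal r rest).posAt r.rel) ((C.reveal r rest).loadedAt r.rel)).dur ≤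
      C.finish - r.rel + Q :=
  ((h.serving.reveal r rest).ret_dur_le hX A hr).trans (add_le_add_right h.dist_le _)

theorem IsIdle.ret_dur_le {x : X} (hX : IsGeodesic X) (A : LazyRule c O) (h : C.IsIdle x)
    (ht : t ∈ Set.Icc C.start C.finish) :
    (A.ret (C.posAt t) (C.loadedAt t)).dur ≤ dist x O := by
  rw [h.loadedAt_eq, h.posAt_eq t ht]
  exact A.ret_empty_dur_le hX x

theorem IsAway.opt_lt_of_lt_ret (hX : IsGeodesic X) (hc : 1 ≤ c) (hα : Real.goldenRatio ≤ α)
    (h : C.IsAway c O α P Q) (hr : r.rel ∈ Set.Icc C.start C.finish)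
    (hlt : α * opt c O (insert r C.known) < r.rel +
      (A.ret ((C.reveal r rest).posAt r.rel) ((C.reveal r rest).loadedAt r.rel)).dur) :
    opt c O (insert r C.known) < 2 * (α * Q) := by
  have hα₁ := one_le_of_goldenRatio_le hα
  have hα₂ := one_add_le_sq_of_goldenRatio_le hα
  have hQ := h.nonneg
  by_contra! hle
  rcases h.phase with hfin | ⟨hidle, -⟩
  · have hret := h.ret_dur_le (rest := rest) hX A hr
    nlinarith
  · have hret := ((hidle.reveal r rest).ret_dur_le hX A hr).trans h.dist_le
    have hrel : r.rel ≤ opt c O (insert r C.known) :=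
      rel_le_opt hX hc (Finset.mem_insert_self _ _)
    nlinarith

theorem IsAway.reveal (hX : IsGeodesic X) (hc : 1 ≤ c) (hα : 1 ≤ α) (h : C.IsAway c O α P Q)
    (hf : C.future = r :: rest) (hr : C.start ≤ r.rel)
    (hlt : opt c O (insert r C.known) < 2 * (α * Q)) :
    (C.reveal r rest).IsAway c O α P Q where
  serving := h.serving.reveal r rest
  nonneg := h.nonneg
  le_opt := h.le_opt.trans (opt_mono hX hc (Finset.subset_insert _ _))
  le_start := h.le_start
  dist_le := h.dist_le
  exists_dst_eq := h.exists_dst_eq.imp fun _ hq => ⟨Finset.mem_insert_of_mem hq.1, hq.2⟩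
  le_rel q hq := by
    obtain ⟨hq, hqP⟩ := Finset.mem_sdiff.1 hq
    rcases Finset.mem_insert.1 hq with rfl | hq
    · exact h.le_start.trans hr
    · exact h.le_rel q (Finset.mem_sdiff.2 ⟨hq, hqP⟩)
  opt_lt _ := hlt
  phase := h.phase.imp_right fun ⟨hidle, hin⟩ =>
    ⟨hidle.reveal r rest, Or.inl (hin.finish_le_insert hX hc hα hf)⟩

theorem LazyInvariant.receive (hX : IsGeodesic X) (hc : 1 ≤ c) (hα : Real.goldenRatio ≤ α)
    (A : LazyRule c O) (h : C.LazyInvariant c O α σ) (hf : C.future = r :: rest)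
    (hr : r.rel ≤ C.finish) : (C.receive A α r rest).LazyInvariant c O α σ := by
  have hα₁ := one_le_of_goldenRatio_le hα
  have hmem : r.rel ∈ Set.Icc C.start C.finish := ⟨h.1.start_le r (by simp [hf]), hr⟩
  refine ⟨h.1.receive hf, ?_⟩
  rcases le_or_gt (r.rel + (A.ret ((C.reveal r rest).posAt r.rel)
    ((C.reveal r rest).loadedAt r.rel)).dur) (α * opt c O (insert r C.known)) with hret | hret
  · rw [receive_eq_execute hret]
    exact Or.inl (isHome_ret hret)
  · rw [receive_eq_reveal hret]
    rcases h.2 with hhome | ⟨P, Q, haway⟩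
    · exact absurd ((hhome.add_ret_dur_le hX A hmem).trans
        (hhome.inTime.finish_le_insert hX hc hα₁ hf)) hret.not_ge
    · exact Or.inr ⟨P, Q, haway.reveal hX hc hα₁ hf hmem.1
        (haway.opt_lt_of_lt_ret hX hc hα hmem hret)⟩

end Receive

section BecomeIdle

theorem LazyInvariant.exists_isServing (h : C.LazyInvariant c O α σ) : ∃ P, C.IsServing c P :=
  h.2.elim (fun h => ⟨_, h.serving⟩) fun ⟨P, _, h⟩ => ⟨P, h.serving⟩

theorem LazyInvariant.finish_le_of_nonempty (hX : IsGeodesic X) (hc : 1 ≤ c)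
    (hα : Real.goldenRatio ≤ α) (h : C.LazyInvariant c O α σ) (hn : ¬ C.ReleaseNext)
    (hw : (C.waitingAt C.finish).Nonempty) : C.finish ≤ α * opt c O C.known := by
  rcases h.2 with hhome | ⟨P, Q, haway⟩
  · exact hhome.inTime.finish_le hn
  · rcases haway.phase with hfin | ⟨-, hin⟩
    · obtain ⟨r, hr⟩ := hw
      have hrel : r.rel ≤ opt c O C.known := rel_le_opt hX hc (h.1.waitingAt_subset _ hr)
      rw [haway.serving.waitingAt_finish] at hr
      nlinarith [haway.le_rel r hr, haway.nonneg, one_le_of_goldenRatio_le hα,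
        one_add_le_sq_of_goldenRatio_le hα]
    · exact hin.finish_le hn

theorem LazyInvariant.sched_dur_le (hX : IsGeodesic X) (hc : 1 ≤ c) (A : LazyRule c O)
    (h : C.LazyInvariant c O α σ) (hw : (C.waitingAt C.finish).Nonempty) :
    (A.sched (C.waitingAt C.finish) (C.posAt C.finish)).dur ≤ opt c O C.known := by
  have hsub := h.1.waitingAt_subset C.finish
  rcases h.2 with hhome | ⟨P, Q, haway⟩
  · rw [hhome.posAt_eq]
    exact (A.sched_shortest _ O).dur_le_opt hX hc hsub
  · obtain ⟨q, hq, hdst⟩ := haway.exists_dst_eq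
    have heq := haway.serving.waitingAt_finish
    rw [← hdst]
    exact (A.sched_shortest _ _).dur_le_opt_of_lt hX hc hsub hw hq (heq ▸ haway.le_rel)
      (haway.opt_lt (heq ▸ hw))

theorem LazyInvariant.finish_le (hα : 1 ≤ α) (h : C.LazyInvariant c O α σ) (hn : ¬ C.ReleaseNext) :
    C.finish ≤ (1 + α) * opt c O C.known := by
  have hinTime (hin : C.InTime c O α) : C.finish ≤ (1 + α) * opt c O C.known := by
    linarith [hin.finish_le hn, opt_nonneg c O C.known]
  rcases h.2 with hhome | ⟨P, Q, haway⟩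
  · exact hinTime hhome.inTime
  · rcases haway.phase with hfin | ⟨-, hin⟩
    · exact hfin.trans (mul_le_mul_of_nonneg_left haway.le_opt (by linarith))
    · exact hinTime hin

theorem IsHome.stay (h : C.IsHome c O α) (hs : 0 ≤ s)
    (hin : (C.execute C.finish (Tour.stay (C.posAt C.finish) s)).InTime c O α) :
    (C.execute C.finish (Tour.stay (C.posAt C.finish) s)).IsHome c O α :=
  ⟨isServing_stay h.serving.loadedAt_finish _ hs, h.posAt_eq, hin⟩

theorem IsAway.stay (h : C.IsAway c O α P Q) (hs : 0 ≤ s)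
    (hin : (C.execute C.finish (Tour.stay (C.posAt C.finish) s)).InTime c O α) :
    (C.execute C.finish (Tour.stay (C.posAt C.finish) s)).IsAway c O α ∅ Q where
  serving := isServing_stay h.serving.loadedAt_finish _ hs
  nonneg := h.nonneg
  le_opt := h.le_opt
  le_start := h.le_start.trans h.serving.start_le_finish
  dist_le := h.dist_le
  exists_dst_eq := h.exists_dst_eq
  le_rel := by
    simp only [waiting_execute, h.serving.waitingAt_finish, Finset.sdiff_empty]
    exact h.le_rel
  opt_lt := by
    simp only [waiting_execute, h.serving.waitingAt_finish, Finset.sdiff_empty]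
    exact h.opt_lt
  phase := Or.inr ⟨IsIdle.stay h.serving.loadedAt_finish _ hs, hin⟩

theorem LazyInvariant.stay (h : C.LazyInvariant c O α σ) (hn : ¬ C.ReleaseNext) (hs : 0 ≤ s)
    (hin : (C.execute C.finish (Tour.stay (C.posAt C.finish) s)).InTime c O α) :
    (C.execute C.finish (Tour.stay (C.posAt C.finish) s)).LazyInvariant c O α σ :=
  ⟨h.1.execute_finish hn _, h.2.imp (fun h => h.stay hs hin)
    fun ⟨_, Q, h⟩ => ⟨∅, Q, h.stay hs hin⟩⟩

theorem isAway_sched (hX : IsGeodesic X) (hc : 1 ≤ c) {x : X} (hl : C.loadedAt t = ∅)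
    (hw : (C.waitingAt t).Nonempty) (hsub : C.waitingAt t ⊆ C.known)
    (ht : t = α * opt c O C.known)
    (hd : (A.sched (C.waitingAt t) x).dur ≤ opt c O C.known) :
    (C.execute t (A.sched (C.waitingAt t) x)).IsAway c O α (C.waitingAt t)
      (opt c O C.known) := by
  obtain ⟨q, hq, -, hdst⟩ := (A.sched_shortest (C.waitingAt t) x).exists_path_dur_eq_dst hw
  have hend : (C.execute t (A.sched (C.waitingAt t) x)).posAt
      (C.execute t (A.sched (C.waitingAt t) x)).finish = q.dst := (posAt_finish _).trans hdst
  exact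
    { serving := isServing_sched A hl x
      nonneg := opt_nonneg _ _ _
      le_opt := le_rfl
      le_start := ht.ge
      dist_le := by
        rw [hend, dist_comm]
        exact dist_dst_le_opt hX hc (hsub hq)
      exists_dst_eq := ⟨q, hsub hq, hend.symm⟩
      le_rel := by simp [execute]
      opt_lt := by simp [execute]
      phase := Or.inl (by simp only [finish, execute]; linarith) }

theorem LazyInvariant.sched (hX : IsGeodesic X) (hc : 1 ≤ c) (hα : Real.goldenRatio ≤ α)
    (A : LazyRule c O) (h : C.LazyInvariant c O α σ) (hn : ¬ C.ReleaseNext)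
    (hle : α * opt c O C.known ≤ C.finish) (hw : (C.waitingAt C.finish).Nonempty) :
    (C.execute C.finish (A.sched (C.waitingAt C.finish) (C.posAt C.finish))).LazyInvariant
      c O α σ := by
  obtain ⟨_, hserving⟩ := h.exists_isServing
  exact ⟨h.1.execute_finish hn _, Or.inr ⟨_, _, isAway_sched hX hc hserving.loadedAt_finish hw
    (h.1.waitingAt_subset _) ((h.finish_le_of_nonempty hX hc hα hn hw).antisymm hle)
    (h.sched_dur_le hX hc A hw)⟩⟩

end BecomeIdle

section Termination

open Classical in
/-- A measure that decreases with every event until all requests are served. Its components are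
the number of future requests, the number of requests not collected by the current command, and
whether the server has to wait (`2`), may act (`1`), or will receive a request (`0`) next. -/
noncomputable def rank (c : ℕ∞) (O : X) (α : ℝ) (C : Config X) : ℕ ×ₗ ℕ ×ₗ ℕ :=
  toLex (C.future.length, toLex ((C.waitingAt C.finish).card,
    if C.finish < α * opt c O C.known then 2 else if C.ReleaseNext then 0 else 1))

theorem rank_receive_lt (hf : C.future = r :: rest) :
    (C.receive A α r rest).rank c O α < C.rank c O α :=
  Prod.Lex.toLex_lt_toLex.2 (Or.inl (by simp [future_receive, hf]))

theorem rank_wait_lt (hlt : C.finish < α * opt c O C.known) (x : X) :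
    (C.execute C.finish (Tour.stay x (α * opt c O C.known - C.finish))).rank c O α <
      C.rank c O α := by
  refine Prod.Lex.toLex_lt_toLex.2 (Or.inr ⟨rfl, Prod.Lex.toLex_lt_toLex.2 (Or.inr ⟨?_, ?_⟩)⟩)
  · rw [waitingAt_stay]
  · simp only [if_pos hlt]
    rw [finish_stay, known_execute, add_sub_cancel, if_neg (lt_irrefl _)]
    split_ifs <;> simp

theorem rank_sched_lt (A : LazyRule c O) (hl : C.loadedAt C.finish = ∅)
    (hw : (C.waitingAt C.finish).Nonempty) (x : X) :
    (C.execute C.finish (A.sched (C.waitingAt C.finish) x)).rank c O α < C.rank c O α := by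
  refine Prod.Lex.toLex_lt_toLex.2 (Or.inr ⟨rfl, Prod.Lex.toLex_lt_toLex.2 (Or.inl ?_)⟩)
  rw [(isServing_sched A hl x).waitingAt_finish]
  simpa [execute] using hw

theorem rank_idle_lt (hn : ¬ C.ReleaseNext) (hle : α * opt c O C.known ≤ C.finish)
    (hf : C.future = r :: rest) (x : X) :
    (C.execute C.finish (Tour.stay x (r.rel - C.finish))).rank c O α < C.rank c O α := by
  have hrel : C.finish < r.rel := by simpa [ReleaseNext, hf] using hn
  have hnext : (C.execute C.finish (Tour.stay x (r.rel - C.finish))).ReleaseNext :=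
    ⟨r, by simp [execute, hf], by rw [finish_stay, add_sub_cancel]⟩
  refine Prod.Lex.toLex_lt_toLex.2 (Or.inr ⟨rfl, Prod.Lex.toLex_lt_toLex.2 (Or.inr ⟨?_, ?_⟩)⟩)
  · rw [waitingAt_stay]
  · simp only [if_neg hle.not_gt, if_neg hn, if_pos hnext]
    rw [finish_stay, known_execute, add_sub_cancel, if_neg (hle.trans hrel.le).not_gt]
    exact Nat.zero_lt_one

theorem LazyInvariant.next (hX : IsGeodesic X) (hc : 1 ≤ c) (hα : Real.goldenRatio ≤ α)
    (A : LazyRule c O) (h : C.LazyInvariant c O α σ) : C.IsDoneAt C.finish ∨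
      (C.next A α).LazyInvariant c O α σ ∧ (C.next A α).rank c O α < C.rank c O α := by
  obtain ⟨_, hserving⟩ := h.exists_isServing
  have hl := hserving.loadedAt_finish
  by_cases hn : C.ReleaseNext
  · obtain ⟨r, hhead, hr⟩ := hn
    obtain ⟨rest, hf⟩ := List.head?_eq_some_iff.1 hhead
    rw [next_eq_receive hf hr]
    exact Or.inr ⟨h.receive hX hc hα A hf hr, rank_receive_lt hf⟩
  rcases lt_or_ge C.finish (α * opt c O C.known) with hlt | hle
  · rw [next_eq_wait hn hlt]
    refine Or.inr ⟨h.stay hn (sub_nonneg.2 hlt.le) (Or.inl ?_), rank_wait_lt hlt _⟩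
    exact (finish_stay _ _ _ _).trans_le (add_sub_cancel _ _).le
  rcases (C.waitingAt C.finish).eq_empty_or_nonempty with hw | hw
  · match hf : C.future with
    | [] => exact Or.inl ⟨hf, hserving.start_le_finish, hw, hl⟩
    | r :: rest =>
      have hrel : C.finish < r.rel := h.1.finish_lt hn r (by simp [hf])
      rw [next_eq_idle hn hle hw hf]
      refine Or.inr ⟨h.stay hn (sub_nonneg.2 hrel.le) (Or.inr ⟨r, ?_, ?_⟩),
        rank_idle_lt hn hle hf _⟩
      · simp [execute, hf]
      · rw [finish_stay, add_sub_cancel]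
  · rw [next_eq_sched hn hle hw]
    exact Or.inr ⟨h.sched hX hc hα A hn hle hw, rank_sched_lt A hl hw _⟩

theorem LazyInvariant.exists_isDoneAt (hX : IsGeodesic X) (hc : 1 ≤ c) (hα : Real.goldenRatio ≤ α)
    (A : LazyRule c O) (h : C.LazyInvariant c O α σ) :
    ∃ m, ((Config.next A α)^[m] C).LazyInvariant c O α σ ∧
      ((Config.next A α)^[m] C).IsDoneAt ((Config.next A α)^[m] C).finish := by
  induction hk : C.rank c O α using WellFoundedLT.induction generalizing C with
  | ind k ih =>
    rcases h.next hX hc hα A with hdone | ⟨h', hlt⟩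
    · exact ⟨0, h, hdone⟩
    · obtain ⟨m, hm⟩ := ih _ (hk ▸ hlt) h' rfl
      exact ⟨m + 1, hm⟩

end Termination

theorem lazyInvariant_init (c : ℕ∞) (O : X) (hα : 0 ≤ α) (hσ : ∀ r ∈ σ, 0 ≤ r.rel)
    (hp : σ.Pairwise fun r r' => r.rel < r'.rel) : (init O σ).LazyInvariant c O α σ where
  left :=
    { known_union := by simp [init]
      pairwise := hp
      start_le := hσ
      waiting_subset := Finset.Subset.refl _ }
  right := Or.inl
    { serving := ⟨Tour.isFeasible_stay O le_rfl, Finset.Subset.refl _, by simp⟩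
      posAt_eq := rfl
      inTime := Or.inl <| by
        have : (init O σ).finish = 0 := add_zero 0
        rw [this]
        exact mul_nonneg hα (opt_nonneg _ _ _) }

end Config

section

variable [MetricSpace X] {O : X} {α : ℝ} {M : Set X} {σ : List (Request X)}

theorem lazyTime_le (hX : IsGeodesic X) (hc : 1 ≤ c) (hα : Real.goldenRatio ≤ α)
    (A : LazyRule c O) (hσ : IsRequestSequence M σ) :
    lazyTime A α σ ≤ ENNReal.ofReal ((1 + α) * opt c O σ.toFinset) := by
  have hα₁ := one_le_of_goldenRatio_le hα
  obtain ⟨m, hinv, hdone⟩ := (Config.lazyInvariant_init c O (zero_le_one.trans hα₁)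
    (fun r hr => (hσ.rel_pos r hr).le) hσ.rel_lt).exists_isDoneAt hX hc hα A
  have hknown := hinv.1.known_union
  rw [hdone.future_eq, List.toFinset_nil, Finset.union_empty] at hknown
  rw [← hknown]
  exact (iInf₂_le _ ⟨m, hdone.future_eq, hdone.start_le, hdone.waitingAt_eq,
    hdone.loadedAt_eq⟩).trans (ENNReal.ofReal_le_ofReal
      (hinv.finish_le hα₁ (by simp [Config.ReleaseNext, hdone.future_eq])))

theorem lazyRatio_le (hX : IsGeodesic X) (hc : 1 ≤ c) (hα : Real.goldenRatio ≤ α)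
    (A : LazyRule c O) (M : Set X) : lazyRatio A α M ≤ ENNReal.ofReal (1 + α) := by
  refine iSup₂_le fun σ hσ => ENNReal.div_le_of_le_mul ?_
  rw [← ENNReal.ofReal_mul (by linarith [one_le_of_goldenRatio_le hα])]
  exact lazyTime_le hX hc hα A hσ

end

end

/-! ### Lower bounds in metric spaces -/

section

variable {X : Type*} {c : ℕ∞}

namespace Config

variable {O : X} {l : List (Request X)} {K : Finset (Request X)} {s t : ℝ}

/-- The configuration in which the server waits at `O` from time `s` to time `t`, while none of
the known requests `K` has been collected, and the requests `l` are still to be released. -/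
noncomputable def standby (O : X) (l : List (Request X)) (K : Finset (Request X)) (s t : ℝ) :
    Config X :=
  ⟨l, K, K, ∅, s, Tour.stay O (t - s)⟩

theorem finish_standby : (standby O l K s t).finish = t := add_sub_cancel s t

end Config

variable [MetricSpace X] {O x : X} {A : LazyRule c O} {α b s t : ℝ} {C : Config X}
  {K W P : Finset (Request X)} {l σ : List (Request X)} {q r : Request X}

theorem LazyRule.dist_add_dist_le_ret_dur (A : LazyRule c O) (x : X) {L : Finset (Request X)}
    (hq : q ∈ L) : dist x q.dst + dist q.dst O ≤ (A.ret x L).dur := by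
  obtain ⟨hfeas, hend⟩ := (A.ret_shortest x L).1
  obtain ⟨p, hp, hpq⟩ := List.mem_map.1 (hfeas.serves.unload_mem (Finset.mem_union_right ∅ hq))
  have hdist := hfeas.isItinerary.dist_le_of_mem hp
  rw [hpq, hend] at hdist
  have hto : dist x q.dst ≤ p.1 - 0 := hdist.1
  have hback : dist q.dst O ≤ (A.ret x L).dur - p.1 := hdist.2
  linarith

theorem opt_empty (c : ℕ∞) (O : X) : opt c O ∅ = 0 :=
  (opt_le (Tour.isFeasible_stay O le_rfl)
    (by simp [Tour.RespectsRelease, Tour.stay])).antisymm (opt_nonneg c O ∅)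

namespace Config

namespace IsServing

theorem dist_posAt_le (h : C.IsServing c P) (ht : t ∈ Set.Icc C.start C.finish) :
    dist (C.tour.path 0) (C.posAt t) ≤ t - C.start := by
  have hst : 0 ≤ t - C.start := sub_nonneg.2 ht.1
  have htd : t - C.start ≤ C.tour.dur := sub_le_iff_le_add'.2 ht.2
  simpa [posAt] using dist_le_sub_of_lipschitzOnWith h.feasible.speed
    ⟨le_rfl, h.feasible.dur_nonneg⟩ ⟨hst, htd⟩ hst

theorem add_dist_point_le_of_mem_executed (h : C.IsServing c P) {a : Act X}
    (ha : a ∈ C.executed t) : C.start + dist (C.tour.path 0) a.point ≤ t := by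
  obtain ⟨s, hs, hst⟩ := mem_executed.1 ha
  have hdist : dist (C.tour.path 0) a.point ≤ s - 0 := (h.feasible.isItinerary.dist_le_of_mem hs).1
  linarith

theorem mem_loadedAt (h : C.IsServing c P) (hload : Act.load q ∈ C.executed t)
    (ht : t < C.start + dist (C.tour.path 0) q.dst) : q ∈ C.loadedAt t := by
  rw [h.loadedAt_eq]
  refine Finset.mem_filter.2 ⟨Finset.mem_union_right _
    (Finset.mem_filter.2 ⟨h.load_mem_executed hload, hload⟩), fun hunload => ?_⟩
  exact ht.not_ge (h.add_dist_point_le_of_mem_executed hunload)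

theorem dist_add_dist_le_ret_dur (h : C.IsServing c P) (A : LazyRule c O)
    (ht : t ∈ Set.Icc C.start C.finish) (hq : q ∈ C.loadedAt t) :
    dist (C.tour.path 0) q.dst + dist q.dst O ≤
      t - C.start + (A.ret (C.posAt t) (C.loadedAt t)).dur := by
  have hret := A.dist_add_dist_le_ret_dur (C.posAt t) hq
  have htri := dist_triangle (C.tour.path 0) (C.posAt t) q.dst
  linarith [h.dist_posAt_le ht]

theorem not_isDoneAt (h : C.IsServing c P) (hr : r ∈ C.waiting) (hP : r ∉ P) (t : ℝ) :
    ¬ C.IsDoneAt t := fun hdone => by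
  have hmem : r ∈ C.waitingAt t :=
    Finset.mem_filter.2 ⟨hr, fun hload => hP (h.load_mem_executed hload)⟩
  simp [hdone.waitingAt_eq] at hmem

theorem add_dist_src_le_of_isDoneAt (h : C.IsServing c P) (hr : r ∈ C.waiting)
    (ht : C.IsDoneAt t) : C.start + dist (C.tour.path 0) r.src ≤ t := by
  refine h.add_dist_point_le_of_mem_executed (a := Act.load r) ?_
  by_contra hload
  have hmem : r ∈ C.waitingAt t := Finset.mem_filter.2 ⟨hr, hload⟩
  simp [ht.waitingAt_eq] at hmem

end IsServing

/-- `Lazy(α)`, continued from the configuration `C`, does not serve all requests before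
time `b`. -/
def NotDoneBefore (A : LazyRule c O) (α b : ℝ) (C : Config X) : Prop :=
  ∀ m t, ((next A α)^[m] C).IsDoneAt t → b ≤ t

theorem NotDoneBefore.of_next (h : ∀ t, ¬ C.IsDoneAt t)
    (hn : (C.next A α).NotDoneBefore A α b) : C.NotDoneBefore A α b
  | 0, t, ht => absurd ht (h t)
  | m + 1, t, ht => hn m t ht

theorem NotDoneBefore.of_next_eq (h : ∀ t, C.IsDoneAt t → b ≤ t) (hn : C.next A α = C) :
    C.NotDoneBefore A α b := fun m t ht => by
  rw [Function.iterate_fixed hn] at ht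
  exact h t ht

/-- The configuration in which the server sets out from `x` at time `t` in order to serve all of
the uncollected requests `W` among the known requests `K`, while the requests `l` are still to be
released. -/
def setOut (A : LazyRule c O) (l : List (Request X)) (K W : Finset (Request X)) (t : ℝ) (x : X) :
    Config X :=
  ⟨l, K, W, ∅, t, A.sched W x⟩

theorem isServing_standby (hst : s ≤ t) : (standby O l K s t).IsServing c ∅ where
  feasible := Tour.isFeasible_stay O (sub_nonneg.2 hst)
  subset := Finset.empty_subset _
  disjoint := Finset.disjoint_empty_left _

theorem isIdle_standby (hst : s ≤ t) : (standby O l K s t).IsIdle O where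
  start_le_finish := (isServing_standby (c := 1) hst).start_le_finish
  loaded_eq := rfl
  acts_eq := rfl
  posAt_eq _ _ := rfl

theorem path_zero_setOut (A : LazyRule c O) : (setOut A l K W t x).tour.path 0 = x :=
  (A.sched_shortest W x).1.path_zero

theorem isServing_setOut : (setOut A l K W t x).IsServing c W where
  feasible := by
    rw [path_zero_setOut]
    exact (A.sched_shortest W x).1
  subset := Finset.Subset.refl W
  disjoint := Finset.disjoint_empty_right W

theorem IsServing.next_eq_setOut (h : C.IsServing c P) (hn : ¬ C.ReleaseNext)
    (hle : α * opt c O C.known ≤ C.finish) (hW : (C.waiting \ P).Nonempty) :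
    C.next A α =
      setOut A C.future C.known (C.waiting \ P) C.finish (C.tour.path C.tour.dur) := by
  have hw := h.waitingAt_finish
  rw [next_eq_sched hn hle (hw ▸ hW)]
  simp only [execute, setOut, hw, h.loadedAt_finish, posAt_finish]

theorem IsServing.next_eq_standby (h : C.IsServing c ∅) (hn : ¬ C.ReleaseNext)
    (hlt : C.finish < α * opt c O C.known) (hend : C.tour.path C.tour.dur = O)
    (hw : C.waiting = C.known) :
    C.next A α = standby O C.future C.known C.finish (α * opt c O C.known) := by
  rw [next_eq_wait hn hlt, execute, h.waitingAt_finish, h.loadedAt_finish, posAt_finish, hend,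
    Finset.sdiff_empty, hw, standby]

theorem next_standby_cons (hr : r.rel ∈ Set.Icc s t)
    (hle : r.rel + (A.ret O ∅).dur ≤ α * opt c O (insert r K)) :
    (standby O (r :: l) K s t).next A α =
      ⟨l, insert r K, insert r K, ∅, r.rel, A.ret O ∅⟩ := by
  have hidle : ((standby O (r :: l) K s t).reveal r l).IsIdle O :=
    (isIdle_standby (hr.1.trans hr.2)).reveal r l
  have hpos : ((standby O (r :: l) K s t).reveal r l).posAt r.rel = O := rfl
  rw [next_eq_receive (r := r) (rest := l) rfl (hr.2.trans_eq finish_standby.symm),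
    receive_eq_execute (by rwa [hpos, hidle.loadedAt_eq]), execute, hpos, hidle.loadedAt_eq,
    hidle.waitingAt_eq]
  rfl

namespace NotDoneBefore

theorem init_cons (hr : 0 < r.rel) (h : (standby O (r :: l) ∅ 0 r.rel).NotDoneBefore A α b) :
    (init O (r :: l)).NotDoneBefore A α b := by
  have hfin : (init O (r :: l)).finish = 0 := add_zero 0
  have hn : ¬ (init O (r :: l)).ReleaseNext := by
    simp only [ReleaseNext, hfin]
    simp [init, hr]
  have hle : α * opt c O (init O (r :: l)).known ≤ (init O (r :: l)).finish := by
    simp only [hfin]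
    simp [init, opt_empty]
  refine .of_next (fun t ht => List.cons_ne_nil r l ht.future_eq) ?_
  rwa [next_eq_idle hn hle rfl rfl, hfin]

theorem standby_cons (hX : IsGeodesic X) (hr : r.rel ∈ Set.Icc s t)
    (hl : ∀ q ∈ l.head?, r.rel < q.rel) (hlt : r.rel < α * opt c O (insert r K))
    (h : (standby O l (insert r K) r.rel (α * opt c O (insert r K))).NotDoneBefore A α b) :
    (standby O (r :: l) K s t).NotDoneBefore A α b := by
  have hreturn := (A.ret_shortest O ∅).1
  have hdur : (A.ret O ∅).dur = 0 :=
    ((A.ret_empty_dur_le hX O).trans_eq (dist_self O)).antisymm hreturn.1.dur_nonneg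
  set C : Config X := ⟨l, insert r K, insert r K, ∅, r.rel, A.ret O ∅⟩
  have hC : C.IsServing c ∅ :=
    ⟨by simpa only [hreturn.1.path_zero, C] using hreturn.1, Finset.empty_subset _,
      Finset.disjoint_empty_left _⟩
  have hfin : C.finish = r.rel := by simp only [finish, hdur, add_zero, C]
  have hn : ¬ C.ReleaseNext := by simpa [ReleaseNext, hfin] using hl
  refine .of_next (fun t ht => List.cons_ne_nil r l ht.future_eq) ?_
  rw [next_standby_cons hr (by rw [hdur, add_zero]; exact hlt.le)]
  refine .of_next (hC.not_isDoneAt (Finset.mem_insert_self r K) (Finset.notMem_empty r)) ?_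
  rw [hC.next_eq_standby hn (hfin.trans_lt hlt) hreturn.2 rfl, hfin]
  exact h

theorem standby_setOut (hst : s ≤ t) (hl : ∀ q ∈ l.head?, t < q.rel) (ht : α * opt c O K ≤ t)
    (hK : K.Nonempty) (h : (setOut A l K K t O).NotDoneBefore A α b) :
    (standby O l K s t).NotDoneBefore A α b := by
  obtain ⟨r, hr⟩ := hK
  have hC : (standby O l K s t).IsServing c ∅ := isServing_standby hst
  have hfin : (standby O l K s t).finish = t := finish_standby
  have hn : ¬ (standby O l K s t).ReleaseNext := by
    rw [ReleaseNext, hfin]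
    simpa [standby] using hl
  refine .of_next (hC.not_isDoneAt hr (Finset.notMem_empty r)) ?_
  rw [hC.next_eq_setOut hn (ht.trans_eq hfin.symm) ⟨r, by simpa [standby] using hr⟩,
    Finset.sdiff_empty, hfin]
  exact h

theorem setOut_nil (hle : α * opt c O K ≤ t) (hr : r ∈ W) :
    (setOut A [] K W t x).NotDoneBefore A α (t + dist x r.src) := by
  have hC : (setOut A [] K W t x).IsServing c W := isServing_setOut
  refine .of_next_eq (fun u hu => ?_) (next_eq_self (hle.trans hC.start_le_finish) ?_ rfl)
  · rw [← path_zero_setOut (x := x) A]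
    exact hC.add_dist_src_le_of_isDoneAt hr hu
  · rw [hC.waitingAt_finish]
    exact Finset.sdiff_self W

theorem setOut_singleton (hr : r ∉ W) (hrel : r.rel ≤ t + (A.sched W x).dur)
    (hret : α * opt c O (insert r K) < r.rel +
      (A.ret (((setOut A [r] K W t x).reveal r []).posAt r.rel)
        (((setOut A [r] K W t x).reveal r []).loadedAt r.rel)).dur)
    (hle : α * opt c O (insert r K) ≤ t + (A.sched W x).dur) :
    (setOut A [r] K W t x).NotDoneBefore A α
      (t + (A.sched W x).dur + dist ((A.sched W x).path (A.sched W x).dur) r.src) := by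
  have hC : ((setOut A [r] K W t x).reveal r []).IsServing c W := isServing_setOut.reveal r []
  have hW : ((setOut A [r] K W t x).reveal r []).waiting \ W = {r} := by
    simp [setOut, reveal, hr]
  refine .of_next (fun t ht => List.cons_ne_nil r [] ht.future_eq) ?_
  rw [next_eq_receive (C := setOut A [r] K W t x) rfl hrel, receive_eq_reveal hret]
  refine .of_next (hC.not_isDoneAt (Finset.mem_insert_self r W) hr) ?_
  rw [hC.next_eq_setOut (by simp [ReleaseNext, reveal]) hle (hW ▸ Finset.singleton_nonempty r), hW]
  exact setOut_nil hle (Finset.mem_singleton_self r)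

end NotDoneBefore

end Config

theorem le_lazyTime (h : (Config.init O σ).NotDoneBefore A α b) :
    ENNReal.ofReal b ≤ lazyTime A α σ :=
  le_iInf₂ fun t ⟨m, hf, hs, hw, hl⟩ => ENNReal.ofReal_le_ofReal (h m t ⟨hf, hs, hw, hl⟩)

theorem ofReal_div_le_lazyRatio (hX : IsGeodesic X) (hc : 1 ≤ c) {M : Set X} {D : ℝ}
    (hσ : IsRequestSequence M σ) (h : (Config.init O σ).NotDoneBefore A α b)
    (hD : opt c O σ.toFinset ≤ D) : ENNReal.ofReal (b / D) ≤ lazyRatio A α M := by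
  obtain ⟨r, hr⟩ := List.exists_mem_of_ne_nil σ hσ.ne_nil
  have hpos : 0 < opt c O σ.toFinset :=
    (hσ.rel_pos r hr).trans_le (rel_le_opt hX hc (List.mem_toFinset.2 hr))
  calc ENNReal.ofReal (b / D)
      = ENNReal.ofReal b / ENNReal.ofReal D := ENNReal.ofReal_div_of_pos (hpos.trans_le hD)
    _ ≤ lazyTime A α σ / ENNReal.ofReal (opt c O σ.toFinset) :=
        ENNReal.div_le_div (le_lazyTime h) (ENNReal.ofReal_le_ofReal hD)
    _ ≤ lazyRatio A α M := le_iSup₂ (f := fun σ (_ : IsRequestSequence M σ) =>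
        lazyTime A α σ / ENNReal.ofReal (opt c O σ.toFinset)) σ hσ

end

/-! ### Opposite pairs and the real line -/

section

theorem isRequestSequence_triple {X : Type*} {q q' r : Request X} (hq : 0 < q.rel)
    (hqq' : q.rel < q'.rel) (hr : q'.rel < r.rel) : IsRequestSequence Set.univ [q, q', r] where
  ne_nil := List.cons_ne_nil q _
  rel_pos := by
    simp only [List.mem_cons, List.not_mem_nil, or_false, forall_eq_or_imp, forall_eq]
    exact ⟨hq, hq.trans hqq', (hq.trans hqq').trans hr⟩
  rel_lt := by simp [hqq', hr, hqq'.trans hr]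
  src_mem _ _ := Set.mem_univ _
  dst_mem _ _ := Set.mem_univ _

variable {X : Type*} {c : ℕ∞} [MetricSpace X] {O : X} {A : LazyRule c O} {α δ t b D : ℝ}
  {P : Finset (Request X)} {q q' r : Request X} {T : Tour X}

/-- Two requests which start at the origin `O`, and whose destinations lie at distance one from
`O`, on different sides: the pair that `Lazy` is confronted with in the lower bound. -/
structure IsOppositePair (O : X) (q q' : Request X) : Prop where
  src_left : q.src = O
  src_right : q'.src = O
  dist_left : dist O q.dst = 1
  dist_right : dist O q'.dst = 1
  dist_dst : dist q.dst q'.dst = 2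

namespace IsOppositePair

theorem symm (h : IsOppositePair O q q') : IsOppositePair O q' q :=
  ⟨h.src_right, h.src_left, h.dist_right, h.dist_left, (dist_comm _ _).trans h.dist_dst⟩

theorem ne (h : IsOppositePair O q q') : q ≠ q' := by
  rintro rfl
  simpa using h.dist_dst

theorem isItinerary (h : IsOppositePair O q q') (hδ : 0 ≤ δ) {l : List (ℝ × Act X)} {z : X}
    (hl : IsItinerary (δ + 3) q.dst l D z) :
    IsItinerary 0 O ((δ, Act.load q') :: (δ + 1, Act.unload q') :: (δ + 2, Act.load q) ::
      (δ + 3, Act.unload q) :: l) D z := by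
  obtain ⟨hq, hq', hd, hd', -⟩ := h
  refine ⟨?_, ?_, ?_, ?_, hl⟩
  · simpa [Act.point, hq'] using hδ
  · simp [Act.point, hq', hd']
  · simp only [Act.point, hq, dist_comm _ O, hd']
    linarith
  · simp only [Act.point, hq, hd]
    linarith

theorem serves_pair (hc : 1 ≤ c) (h : IsOppositePair O q q') :
    Serves c {q, q'} ∅ [Act.load q', Act.unload q', Act.load q, Act.unload q] := by
  rw [Finset.pair_comm]
  exact Serves.cons_cons hc (by simpa using h.ne.symm)
    (Serves.cons_cons hc (Finset.notMem_empty q) ⟨rfl, rfl⟩)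

theorem exists_load_add_three_le (h : IsOppositePair O q q') (hT : T.IsFeasible c P ∅ O)
    (hq : q ∈ P) (hq' : q' ∈ P) :
    (∃ s, 0 ≤ s ∧ (s, Act.load q) ∈ T.acts ∧ s + 3 + dist q'.dst (T.path T.dur) ≤ T.dur) ∨
      ∃ s, 0 ≤ s ∧ (s, Act.load q') ∈ T.acts ∧ s + 3 + dist q.dst (T.path T.dur) ≤ T.dur := by
  obtain ⟨s, u, hs, hu, -, hsu, hend⟩ := hT.exists_load_unload hq
  obtain ⟨s', u', hs', hu', -, hsu', hend'⟩ := hT.exists_load_unload hq'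
  have hbetween := hT.speed.dist_le_mul _ (hT.time_mem _ hu) _ (hT.time_mem _ hu')
  simp only [hT.path_time _ hu, hT.path_time _ hu', Act.point, h.dist_dst, Real.dist_eq,
    NNReal.coe_one, one_mul] at hbetween
  simp only [IsItinerary, Act.point, h.src_left, h.src_right, h.dist_left, h.dist_right]
    at hsu hend hsu' hend'
  rcases le_total u u' with huu | huu
  · rw [abs_sub_comm, abs_of_nonneg (sub_nonneg.2 huu)] at hbetween
    exact Or.inl ⟨s, (hT.time_mem _ hs).1, hs, by linarith⟩
  · rw [abs_of_nonneg (sub_nonneg.2 huu)] at hbetween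
    exact Or.inr ⟨s', (hT.time_mem _ hs').1, hs', by linarith⟩

theorem three_le_dur (h : IsOppositePair O q q') (hT : T.IsFeasible c P ∅ O)
    (hq : q ∈ P) (hq' : q' ∈ P) : 3 ≤ T.dur := by
  rcases h.exists_load_add_three_le hT hq hq' with ⟨s, hs, -, hle⟩ | ⟨s, hs, -, hle⟩
  · linarith [dist_nonneg (x := q'.dst) (y := T.path T.dur)]
  · linarith [dist_nonneg (x := q.dst) (y := T.path T.dur)]

theorem exists_pair_eq (h : IsOppositePair O q q') (hT : T.IsFeasible c {q, q'} ∅ O)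
    (hdur : T.dur ≤ 3) :
    ∃ p p', IsOppositePair O p p' ∧ ({p, p'} : Finset (Request X)) = {q, q'} ∧
      (0, Act.load p) ∈ T.acts ∧ T.path T.dur = p'.dst := by
  have hload_zero : ∀ {s : ℝ} {y : X}, 0 ≤ s → s + 3 + dist y (T.path T.dur) ≤ T.dur →
      s = 0 ∧ T.path T.dur = y := fun {s y} hs hle => by
    have hnonneg := dist_nonneg (x := y) (y := T.path T.dur)
    exact ⟨by linarith, (dist_le_zero.1 (by linarith)).symm⟩
  rcases h.exists_load_add_three_le hT (by simp) (by simp) with ⟨s, hs, hload, hle⟩ |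
    ⟨s, hs, hload, hle⟩
  · obtain ⟨rfl, hend⟩ := hload_zero hs hle
    exact ⟨q, q', h, rfl, hload, hend⟩
  · obtain ⟨rfl, hend⟩ := hload_zero hs hle
    exact ⟨q', q, h.symm, Finset.pair_comm q' q, hload, hend⟩

theorem sched_dur (h : IsOppositePair O q q') (hX : IsGeodesic X) (hc : 1 ≤ c)
    (A : LazyRule c O) : (A.sched {q, q'} O).dur = 3 := by
  have hS := A.sched_shortest {q, q'} O
  refine le_antisymm ?_ (h.three_le_dur hS.1 (by simp) (by simp))
  have hend : IsItinerary ((0 : ℝ) + 3) q.dst [] 3 q.dst := by simp [IsItinerary]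
  simpa using hS.dur_le hX (h.isItinerary le_rfl hend) (h.serves_pair hc)

theorem three_le_opt (h : IsOppositePair O q q') (hX : IsGeodesic X) (hc : 1 ≤ c) :
    3 ≤ opt c O {q, q'} :=
  le_opt hX hc fun _ hT _ => h.three_le_dur hT (by simp) (by simp)

theorem opt_le (h : IsOppositePair O q q') (hX : IsGeodesic X) (hc : 1 ≤ c) (hδ : 0 ≤ δ)
    (hq : q.rel ≤ δ) (hq' : q'.rel ≤ δ) : opt c O {q, q'} ≤ δ + 3 := by
  have hend : IsItinerary (δ + 3) q.dst [] (δ + 3) q.dst := by simp [IsItinerary]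
  refine opt_le_of_isItinerary hX (h.isItinerary hδ hend) (h.serves_pair hc) fun s r hr => ?_
  simp only [List.mem_cons, Prod.mk.injEq, Act.load.injEq, reduceCtorEq, and_false, false_or,
    List.not_mem_nil, or_false] at hr
  rcases hr with ⟨rfl, rfl⟩ | ⟨rfl, rfl⟩ <;> linarith

theorem opt_insert_le (h : IsOppositePair O q q') (hX : IsGeodesic X) (hc : 1 ≤ c) (hδ : 0 ≤ δ)
    (hq : q.rel ≤ δ) (hq' : q'.rel ≤ δ) (hrq : r ≠ q) (hrq' : r ≠ q') (hr : r.dst = r.src)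
    (hrel : r.rel ≤ D) (hD : δ + 3 + dist q.dst r.src ≤ D) :
    opt c O {r, q, q'} ≤ D := by
  have hend : IsItinerary (δ + 3) q.dst [(D, Act.load r), (D, Act.unload r)] D r.dst := by
    simp only [IsItinerary, Act.point, hr, dist_self, sub_self, le_refl, and_self, and_true]
    linarith
  have hserves : Serves c {r, q, q'} ∅ [Act.load q', Act.unload q', Act.load q, Act.unload q,
      Act.load r, Act.unload r] := by
    have hset : ({r, q, q'} : Finset (Request X)) = {q', q, r} := by grind
    rw [hset]
    exact Serves.cons_cons hc (by simp [h.ne.symm, hrq'.symm]) (Serves.cons_cons hc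
      (by simpa using hrq.symm) (Serves.cons_cons hc (Finset.notMem_empty r) ⟨rfl, rfl⟩))
  refine opt_le_of_isItinerary hX (h.isItinerary hδ hend) hserves fun s p hp => ?_
  simp only [List.mem_cons, Prod.mk.injEq, Act.load.injEq, reduceCtorEq, and_false, false_or,
    List.not_mem_nil, or_false] at hp
  rcases hp with ⟨rfl, rfl⟩ | ⟨rfl, rfl⟩ | ⟨rfl, rfl⟩ <;> linarith

open Config in
theorem notDoneBefore_setOut (h : IsOppositePair O q q') (hX : IsGeodesic X) (hc : 1 ≤ c)
    (hδ : 0 ≤ δ) (hδ' : δ < 1) (hload : (0, Act.load q) ∈ (A.sched {q, q'} O).acts)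
    (hend : (A.sched {q, q'} O).path (A.sched {q, q'} O).dur = q'.dst)
    (hrq : r ≠ q) (hrq' : r ≠ q') (hrel : r.rel = t + δ)
    (hopt : α * opt c O {r, q, q'} < t + 2) :
    (setOut A [r] {q, q'} {q, q'} t O).NotDoneBefore A α (t + 3 + dist q'.dst r.src) := by
  have hdur := h.sched_dur hX hc A
  set C := (setOut A [r] {q, q'} {q, q'} t O).reveal r [] with hCdef
  have hC : C.IsServing c {q, q'} := isServing_setOut.reveal r []
  have hfin : C.finish = t + 3 := congrArg (t + ·) hdur
  have hstart : C.tour.path 0 = O := (A.sched_shortest {q, q'} O).1.path_zero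
  have hrel_mem : r.rel ∈ Set.Icc C.start C.finish :=
    ⟨hrel.ge.trans' (le_add_of_nonneg_right hδ), by linarith⟩
  have hloaded : q ∈ C.loadedAt r.rel := by
    refine hC.mem_loadedAt (mem_executed.2 ⟨0, hload, ?_⟩) ?_
    · rw [add_zero]
      exact hrel_mem.1
    · rw [hstart, h.dist_left]
      exact hrel.trans_lt (add_lt_add_right hδ' t)
  have hret := hC.dist_add_dist_le_ret_dur A hrel_mem hloaded
  rw [hstart, dist_comm q.dst, h.dist_left] at hret
  have hCstart : C.start = t := rfl
  rw [← hend, ← hdur]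
  refine NotDoneBefore.setOut_singleton (by simp [hrq, hrq']) (by linarith) ?_ (by linarith)
  rw [← hCdef]
  linarith

open Config in
theorem notDoneBefore_init (h : IsOppositePair O q q') (hX : IsGeodesic X) (hc : 1 ≤ c)
    (hα : 1 ≤ α) (hq : 0 < q.rel) (hqq' : q.rel < q'.rel) (hq' : q'.rel < 1)
    (hr : α * opt c O {q, q'} < r.rel)
    (hb : (setOut A [r] {q, q'} {q, q'} (α * opt c O {q, q'}) O).NotDoneBefore A α b) :
    (init O [q, q', r]).NotDoneBefore A α b := by
  have hopt_left : 1 ≤ α * opt c O {q} := by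
    have hdst := dist_dst_le_opt (O := O) hX hc (Finset.mem_singleton_self q)
    exact one_le_mul_of_one_le_of_one_le hα (h.dist_left.ge.trans hdst)
  have hopt_pair : 1 ≤ α * opt c O {q, q'} :=
    one_le_mul_of_one_le_of_one_le hα ((h.three_le_opt hX hc).trans' (by norm_num))
  have hset : insert q' (insert q ∅) = ({q, q'} : Finset (Request X)) := Finset.pair_comm q' q
  refine .init_cons hq (.standby_cons hX ⟨hq.le, le_rfl⟩ (by simpa using hqq') ?_
    (.standby_cons hX ⟨hqq'.le, ?_⟩ ?_ ?_ ?_))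
  · rw [insert_empty_eq]
    linarith
  · rw [insert_empty_eq]
    linarith
  · rw [List.head?_cons]
    rintro _ ⟨⟩
    linarith
  · rw [hset]
    linarith
  · rw [hset]
    exact .standby_setOut (by linarith) (by simpa using hr) le_rfl (Finset.insert_nonempty q _) hb

end IsOppositePair

section Real

variable {A : LazyRule c (0 : ℝ)}

theorem isGeodesic_real : IsGeodesic ℝ := by
  intro x y
  rcases le_total x y with hxy | hyx
  · refine ⟨fun s => x + s, add_zero x, ?_, fun s _ t _ => by simp [Real.dist_eq]⟩
    rw [Real.dist_eq, abs_sub_comm, abs_of_nonneg (sub_nonneg.2 hxy)]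
    exact add_sub_cancel x y
  · refine ⟨fun s => x - s, sub_zero x, ?_, fun s _ t _ => ?_⟩
    · rw [Real.dist_eq, abs_of_nonneg (sub_nonneg.2 hyx)]
      exact sub_sub_cancel x y
    · rw [Real.dist_eq, sub_sub_sub_cancel_left, abs_sub_comm]

open Config in
theorem one_add_le_lazyRatio (hc : 1 ≤ c) (A : LazyRule c (0 : ℝ)) (hα : 1 ≤ α) :
    ENNReal.ofReal (1 + α) ≤ lazyRatio A α Set.univ := by
  have hX := isGeodesic_real
  let r : Request ℝ := ⟨1, 1, 1 / 2⟩
  have hitinerary : IsItinerary 0 0 [(1, Act.load r), (1, Act.unload r)] 1 r.dst := by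
    simp [IsItinerary, Act.point, r]
  have hopt_le : opt c 0 {r} ≤ 1 :=
    opt_le_of_isItinerary hX hitinerary (Serves.cons_cons hc (Finset.notMem_empty r) ⟨rfl, rfl⟩)
      (by simp [r]; norm_num)
  have hopt_ge : dist 0 r.dst ≤ opt c 0 {r} :=
    dist_dst_le_opt hX hc (Finset.mem_singleton_self r)
  have hopt : opt c 0 {r} = 1 := hopt_le.antisymm (by simpa [r] using hopt_ge)
  have hσ : IsRequestSequence Set.univ [r] := ⟨by simp, by simp [r], by simp, by simp, by simp⟩
  have hlate : (init 0 [r]).NotDoneBefore A α (1 + α) := by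
    refine .init_cons (by norm_num [r]) (.standby_cons hX (by norm_num [r]) (by simp) ?_ ?_)
    · rw [insert_empty_eq, hopt]
      norm_num [r]
      linarith
    · rw [insert_empty_eq, hopt, mul_one]
      have hrel : r.rel ≤ α := by
        norm_num [r]
        linarith
      have hdist : dist 0 r.src = 1 := by simp [r]
      rw [add_comm, ← hdist]
      exact .standby_setOut hrel (by simp) (by rw [hopt, mul_one]) (Finset.singleton_nonempty r)
        (.setOut_nil (by rw [hopt, mul_one]) (Finset.mem_singleton_self r))
  simpa using ofReal_div_le_lazyRatio hX hc hσ hlate (D := 1) (by simpa using hopt_le)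

theorem isOppositePair_real (s t : ℝ) : IsOppositePair (0 : ℝ) ⟨0, 1, s⟩ ⟨0, -1, t⟩ :=
  ⟨rfl, rfl, by simp, by simp, by norm_num [Real.dist_eq]⟩

theorem IsOppositePair.exists_beyond {q q' : Request ℝ} (h : IsOppositePair 0 q q') {a : ℝ}
    (ha : 0 ≤ a) : ∃ y, dist q.dst y = a ∧ dist q'.dst y = a + 2 := by
  obtain ⟨-, -, hq, hq', hqq'⟩ := h
  rw [dist_zero_left, Real.norm_eq_abs, abs_eq zero_le_one] at hq hq'
  refine ⟨(1 + a) * q.dst, ?_⟩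
  rcases hq with hq | hq <;> rcases hq' with hq' | hq' <;> rw [hq, hq', Real.dist_eq] at hqq' <;>
    norm_num at hqq'
  all_goals
    rw [hq, hq', Real.dist_eq, Real.dist_eq]
    constructor
  · rw [abs_of_nonpos] <;> linarith
  · rw [abs_of_nonpos] <;> linarith
  · rw [abs_of_nonneg] <;> linarith
  · rw [abs_of_nonneg] <;> linarith

open Config in
theorem IsOppositePair.exists_third_request {q q' : Request ℝ} (h : IsOppositePair 0 q q')
    (hc : 1 ≤ c) (hα : 1 ≤ α) (hδ : 0 < δ) (hδ' : δ < 1) (hq : q.rel ≤ δ) (hq' : q'.rel ≤ δ)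
    (ht : 3 * α ≤ t) (hlt : α * (t + δ) < t + 2)
    (hload : (0, Act.load q) ∈ (A.sched {q, q'} 0).acts)
    (hend : (A.sched {q, q'} 0).path (A.sched {q, q'} 0).dur = q'.dst) :
    ∃ r : Request ℝ, r.rel = t + δ ∧ opt c 0 {r, q, q'} ≤ t + δ ∧
      (setOut A [r] {q, q'} {q, q'} t 0).NotDoneBefore A α (t + (3 * α + 2)) := by
  have hX := isGeodesic_real
  -- `Lazy` ends up at `q'.dst`, while an offline server that delivers `q` last can walk on from
  -- `q.dst` to `y` by time `δ + 3 * α`, which is at most the release time `t + δ`.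
  obtain ⟨y, hy, hy'⟩ := h.exists_beyond (a := 3 * α - 3) (by linarith)
  let r : Request ℝ := ⟨y, y, t + δ⟩
  have hne : ∀ p : Request ℝ, p.rel ≤ δ → r ≠ p := fun p hp hrp => by
    have hrel : t + δ ≤ δ := (congrArg Request.rel hrp).trans_le hp
    linarith
  have hD : δ + 3 + dist q.dst y ≤ t + δ := by linarith
  have hopt : opt c 0 {r, q, q'} ≤ t + δ :=
    h.opt_insert_le hX hc hδ.le hq hq' (hne q hq) (hne q' hq') rfl le_rfl hD
  have hlate := h.notDoneBefore_setOut (A := A) (α := α) hX hc hδ.le hδ' hload hend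
    (hne q hq) (hne q' hq') rfl ((mul_le_mul_of_nonneg_left hopt (by linarith)).trans_lt hlt)
  have hy_add : t + 3 + dist q'.dst r.src = t + (3 * α + 2) := by
    rw [show r.src = y from rfl, hy']
    ring
  exact ⟨r, rfl, hopt, hy_add ▸ hlate⟩

open Config in
theorem ofReal_div_le_lazyRatio_of_small (hc : 1 ≤ c) (A : LazyRule c (0 : ℝ)) (hα : 1 ≤ α)
    (hδ : 0 < δ) (hδ' : δ < 1) (hαδ : 3 * α ^ 2 - 3 * α + α ^ 2 * δ < 2) :
    ENNReal.ofReal ((α * (3 + δ) + (3 * α + 2)) / (α * (3 + δ) + δ)) ≤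
      lazyRatio A α Set.univ := by
  have hX := isGeodesic_real
  obtain ⟨r₁, r₂, hpair, hrel₁, hrel₂⟩ : ∃ r₁ r₂ : Request ℝ,
      IsOppositePair 0 r₁ r₂ ∧ r₁.rel = δ / 2 ∧ r₂.rel = δ :=
    ⟨_, _, isOppositePair_real (δ / 2) δ, rfl, rfl⟩
  have hrel : ∀ p ∈ ({r₁, r₂} : Finset (Request ℝ)), p.rel ≤ δ := by
    simp only [Finset.mem_insert, Finset.mem_singleton, forall_eq_or_imp, forall_eq]
    constructor <;> linarith
  have hopt_ge := hpair.three_le_opt hX hc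
  have hopt_le := hpair.opt_le hX hc hδ.le (hrel r₁ (by simp)) (hrel r₂ (by simp))
  set t := α * opt c 0 {r₁, r₂}
  have ht_ge : 3 * α ≤ t := by nlinarith
  have ht_le : t ≤ α * (3 + δ) := by nlinarith
  obtain ⟨q, q', hqq', hset, hload, hend⟩ :=
    hpair.exists_pair_eq (A.sched_shortest {r₁, r₂} 0).1 (hpair.sched_dur hX hc A).le
  rw [← hset] at hload hend hrel
  obtain ⟨r, hr, hopt, hsetOut⟩ := hqq'.exists_third_request hc hα hδ hδ' (hrel q (by simp))
    (hrel q' (by simp)) ht_ge (by nlinarith) hload hend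
  have hσ : IsRequestSequence Set.univ [r₁, r₂, r] :=
    isRequestSequence_triple (by linarith) (by linarith) (by linarith)
  have hlate : (init 0 [r₁, r₂, r]).NotDoneBefore A α (t + (3 * α + 2)) := by
    rw [hset] at hsetOut
    exact hpair.notDoneBefore_init hX hc hα (by linarith) (by linarith) (by linarith)
      (by linarith) hsetOut
  have hσ_opt : opt c 0 [r₁, r₂, r].toFinset ≤ t + δ := by
    have hσ_set : [r₁, r₂, r].toFinset = {r, q, q'} := by
      ext p
      simp only [hset, List.mem_toFinset, List.mem_cons, List.not_mem_nil, or_false,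
        Finset.mem_insert, Finset.mem_singleton]
      tauto
    rwa [hσ_set]
  refine (ENNReal.ofReal_le_ofReal ?_).trans (ofReal_div_le_lazyRatio hX hc hσ hlate hσ_opt)
  rw [div_le_div_iff₀ (by linarith) (by linarith)]
  nlinarith

theorem two_add_le_lazyRatio (hc : 1 ≤ c) (A : LazyRule c (0 : ℝ)) (hα : 1 ≤ α)
    (hα' : 3 * α ^ 2 - 3 * α < 2) :
    ENNReal.ofReal (2 + 2 / (3 * α)) ≤ lazyRatio A α Set.univ := by
  have hlim : Filter.Tendsto (fun δ : ℝ => (α * (3 + δ) + (3 * α + 2)) / (α * (3 + δ) + δ))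
      (nhdsWithin 0 (Set.Ioi 0)) (nhds (2 + 2 / (3 * α))) := by
    have hcont : ContinuousAt (fun δ : ℝ => (α * (3 + δ) + (3 * α + 2)) / (α * (3 + δ) + δ)) 0 :=
      ContinuousAt.div₀ (by fun_prop) (by fun_prop) (by positivity)
    convert hcont.tendsto.mono_left nhdsWithin_le_nhds using 2
    field_simp
    ring
  have hsmall : ∀ᶠ δ in nhds (0 : ℝ), 3 * α ^ 2 - 3 * α + α ^ 2 * δ < 2 :=
    ContinuousAt.eventually_lt (by fun_prop) continuousAt_const (by simpa using hα')
  refine le_of_tendsto (ENNReal.tendsto_ofReal hlim) ?_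
  filter_upwards [self_mem_nhdsWithin, nhdsWithin_le_nhds (gt_mem_nhds one_pos),
    nhdsWithin_le_nhds hsmall] with δ hδ hδ' hαδ
  exact ofReal_div_le_lazyRatio_of_small hc A hα hδ hδ' hαδ

theorem max_le_lazyRatio (hc : 1 ≤ c) (A : LazyRule c (0 : ℝ)) (hα : 1 ≤ α) :
    ENNReal.ofReal (max (1 + α) (2 + 2 / (3 * α))) ≤ lazyRatio A α Set.univ := by
  rcases le_or_gt (2 + 2 / (3 * α)) (1 + α) with hle | hlt
  · rw [max_eq_left hle]
    exact one_add_le_lazyRatio hc A hα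
  · rw [max_eq_right hlt.le]
    have hsub : α - 1 < 2 / (3 * α) := by linarith
    rw [lt_div_iff₀ (by positivity)] at hsub
    exact two_add_le_lazyRatio hc A hα (by linarith)

end Real

end

end DialARide

theorem theorem1_general (c : ℕ∞) (hc : 1 ≤ c) :
    (∀ (X : Type*) [MetricSpace X] (O : X), IsGeodesic X → Nonempty (LazyRule c O) ∧
      ∀ (A : LazyRule c O) (α : ℝ), Real.goldenRatio ≤ α → ∀ M : Set X,
        lazyRatio A α M ≤ ENNReal.ofReal (1 + α)) ∧
    (∀ (A : LazyRule c (0 : ℝ)) (α : ℝ), Real.goldenRatio ≤ α →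
      lazyRatio A α Set.univ = ENNReal.ofReal (1 + α)) ∧
    (∀ α : ℝ, 1 ≤ α → ∀ A : LazyRule c (0 : ℝ),
      ENNReal.ofReal (max (1 + α) (2 + 2 / (3 * α))) ≤ lazyRatio A α Set.univ) := by
  refine ⟨fun X _ O hX => ⟨nonempty_lazyRule hX hc O, fun A α hα => lazyRatio_le hX hc hα A⟩,
    fun A α hα => ?_, fun α hα A => max_le_lazyRatio hc A hα⟩
  exact (lazyRatio_le isGeodesic_real hc hα A Set.univ).antisymm
    (one_add_le_lazyRatio hc A (one_le_of_goldenRatio_le hα))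

theorem theorem1 (c : ℕ∞) (hc : 1 ≤ c) :
    -- upper bound on general metric spaces `M`; the server moves in a geodesic space `X ⊇ M`
    (∀ (M : Type*) [MetricSpace M] (X : Type*) [MetricSpace X] (ι : M → X) (O : M),
      Isometry ι → IsGeodesic X →
        Nonempty (LazyRule c (ι O)) ∧
        ∀ A : LazyRule c (ι O),
          lazyRatio A Real.goldenRatio (Set.range ι) ≤ ENNReal.ofReal (1 + Real.goldenRatio)) ∧
    -- the upper bound is attained, already on the real line
    (∀ A : LazyRule c (0 : ℝ),
      lazyRatio A Real.goldenRatio Set.univ = ENNReal.ofReal (1 + Real.goldenRatio)) ∧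
    -- lower bound for all parameters, on the real line
    (∀ α : ℝ, 1 ≤ α → ∀ A : LazyRule c (0 : ℝ),
      ENNReal.ofReal (max (1 + α) (2 + 2 / (3 * α))) ≤ lazyRatio A α Set.univ) := by
  obtain ⟨hupper, htight, hlower⟩ := theorem1_general c hc
  exact ⟨fun M _ X _ ι O _ hX => ⟨(hupper X (ι O) hX).1, fun A =>
    (hupper X (ι O) hX).2 A _ le_rfl _⟩, fun A => htight A _ le_rfl, hlower⟩
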